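/- **Theorem (directed Hamiltonian path).** In the CONGEST model, $n$ vertices with distinct identifiers communicate in synchronous rounds; in each round every vertex may send a message of $O(\log n)$ bits to each of its neighbours, and local computation is unrestricted. The input is a directed graph $G$ on the $n$ vertices without loops, whose underlying undirected graph is connected; this undirected graph is the communication network (edges carry messages in both directions), and each vertex initially knows $n$, its own identifier, and its out-neighbours and in-neighbours in $G$. A directed Hamiltonian path of $G$ is a directed path that visits every vertex exactly once. Then any distributed algorithm in the CONGEST model, deterministic or randomized with success probability at least $2/3$ on every input graph, for either of the following problems requires $\Omega(n^2/\log^4 n)$ rounds: 1. finding a directed Hamiltonian path: if $G$ has a directed Hamiltonian path, then every vertex has to output its successor on one and the same such path (the last vertex outputs that it has none); if $G$ has no directed Hamiltonian path, the output may be arbitrary; 2. deciding whether $G$ has a directed Hamiltonian path: all vertices accept if and only if there is one. Precisely: for every bandwidth function $b(n)=O(\log n)$ and each of the two problems there is a constant $c>0$ such that for all sufficiently large $n$, every algorithm with messages of at most $b(n)$ bits that solves the problem on all $n$-vertex input graphs within $T$ rounds satisfies $T\ge c\,n^2/\log^4 n$. This holds even if the coin flips of a randomized algorithm are shared by all vertices.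 -/

import Mathlib

open Filter Asymptotics MeasureTheory

/-- A message of at most `b` bits. -/
abbrev Message (b : ℕ) : Type := {l : List Bool // l.length ≤ b}

/-- A deterministic synchronous message-passing algorithm for networks of `n` vertices with
bandwidth `b`. The vertices are named by their identifiers, the elements of `Fin n`.
There is no restriction on the local computation, and the algorithm may depend on `n`.

* `init v O I` is the initial state of the vertex `v` whose set of out-neighbours in the directed
  input graph is `O` and whose set of in-neighbours is `I`;
* `send s u` is the message that a vertex in state `s` sends to its neighbour `u`;
* `step s m` is the new state of a vertex that was in state `s` and has received the messages `m`
  in the current round, where `m u = none` if `u` is not a neighbour;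
* `out s` is the output of a vertex in state `s`. -/
structure CongestAlgorithm (n b : ℕ) (Out : Type) where
  State : Type
  init : Fin n → Set (Fin n) → Set (Fin n) → State
  send : State → Fin n → Message b
  step : State → (Fin n → Option (Message b)) → State
  out : State → Out

namespace CongestAlgorithm

variable {n b : ℕ} {Out : Type}

open Classical in
/-- The states of all vertices after `t` rounds of the algorithm `A` on the directed graph `G`.
In every round, each vertex sends a message of at most `b` bits to each of its neighbours in the
underlying undirected graph; so an edge carries messages both ways, whatever its direction. -/
noncomputable def states (A : CongestAlgorithm n b Out) (G : Digraph (Fin n)) :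
    ℕ → Fin n → A.State
  | 0 => fun v => A.init v {w | G.Adj v w} {w | G.Adj w v}
  | t + 1 => fun v => A.step (A.states G t v) fun u =>
      if G.toSimpleGraphInclusive.Adj u v then some (A.send (A.states G t u) v) else none

/-- The outputs of all vertices after `T` rounds of `A` on `G`. -/
noncomputable def output (A : CongestAlgorithm n b Out) (G : Digraph (Fin n)) (T : ℕ)
    (v : Fin n) : Out :=
  A.out (A.states G T v)

end CongestAlgorithm

/-- The possible inputs: directed graphs without loops (antiparallel edges are allowed) whose
underlying undirected graph, which is the communication network, is connected. -/
def IsInputGraph {n : ℕ} (G : Digraph (Fin n)) : Prop :=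
  (∀ v, ¬ G.Adj v v) ∧ G.toSimpleGraphInclusive.Connected

/-- The list `l` of vertices is a directed Hamiltonian path of `G`: it visits every vertex exactly
once, and there is an edge from each vertex of the list to the next one. -/
def IsDirHamPath {n : ℕ} (G : Digraph (Fin n)) (l : List (Fin n)) : Prop :=
  l.Nodup ∧ (∀ v, v ∈ l) ∧ l.IsChain G.Adj

/-- The outputs `out` decide correctly whether `G` has a directed Hamiltonian path:
all vertices accept if and only if there is such a path. -/
def CorrectDecision {n : ℕ} (G : Digraph (Fin n)) (out : Fin n → Bool) : Prop :=
  (∀ v, out v = true) ↔ ∃ l, IsDirHamPath G l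

/-- The outputs `out` describe a directed Hamiltonian path of `G`: each vertex outputs its
successor on the path, and the last vertex outputs `none`. -/
def DescribesHamPath {n : ℕ} (G : Digraph (Fin n)) (out : Fin n → Option (Fin n)) : Prop :=
  ∃ l, IsDirHamPath G l ∧ ∀ (i : ℕ) (hi : i < l.length), out l[i] = l[i + 1]?

/-- If `G` has a directed Hamiltonian path, then the outputs `out` describe one.
Nothing is asked for if `G` has none. -/
def CorrectSearch {n : ℕ} (G : Digraph (Fin n)) (out : Fin n → Option (Fin n)) : Prop :=
  (∃ l, IsDirHamPath G l) → DescribesHamPath G out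

/-- `A` is a randomized algorithm: `ω` is the outcome of all coin flips, and `A ω` is the
deterministic algorithm that is then performed (a deterministic algorithm is one that does not
depend on `ω`; private coins are the case in which a vertex uses only its own part of `ω`).
It solves the problem with correctness condition `Correct` in `T` rounds if, on every input graph,
its outputs after `T` rounds are correct with probability at least `2 / 3`. -/
def SolvesInRounds {n b : ℕ} {Out Ω : Type} [MeasurableSpace Ω] (μ : Measure Ω)
    (A : Ω → CongestAlgorithm n b Out)
    (Correct : Digraph (Fin n) → (Fin n → Out) → Prop) (T : ℕ) : Prop :=
  ∀ G : Digraph (Fin n), IsInputGraph G →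
    MeasurableSet {ω | Correct G ((A ω).output G T)} ∧
      2 / 3 ≤ μ.real {ω | Correct G ((A ω).output G T)}

/-!
The lower bound is a reduction from set disjointness. Two players hold subsets of a ground set of
`4 ^ ℓ` pairs of `ℓ`-bit values, and the gadget graph on `O(ℓ * 2 ^ ℓ)` vertices, in which each
player knows his own part, has a directed Hamiltonian path if and only if the sets meet. Only
`O(ℓ)` edges join the two parts, so the players can simulate `T` rounds of an algorithm by
exchanging `O(T * ℓ * b)` bits (`exp_card_le_of_solvesInRounds`). Since the randomized communication
complexity of disjointness is linear, `4 ^ ℓ = O(T * ℓ * b)`, and `n ≈ ℓ * 2 ^ ℓ` and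
`b = O(log n)` give `T = Ω(n ^ 2 / log ^ 4 n)`.

*Disjointness* (`exp_card_le_of_protocol`). The transcripts of a protocol cut the matrix of inputs
into rectangles. By `corruption`, a rectangle with a noticeable mass of disjoint pairs has
a constant fraction of it as mass of intersecting pairs. This is Razborov's argument, with a product
distribution in place of sets of fixed size, for which the entropy estimate becomes a
bound on an exponential moment (`subCount_le_of_biased`). Public coins turn the probability of a
verdict into a nonnegative combination of rectangles. A fixed power of such a combination is one
again, which amplifies the success probability `2 / 3` without repeating the protocol. As only
finitely many events matter, an arbitrary probability space of coins can be replaced by a finite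
mixture (`exists_finite_mixture`).

*The gadget.* For each bit of the two coordinates of a pair there is a row, a path of cells that a
Hamiltonian path traverses in one of two directions; these directions spell out a pair `D`. Each
player has a clause vertex for each value of each coordinate. It can be visited during the
traversal of a row if and only if the value differs from the one in `D` in the bit of this row.
So the clauses of the two values in `D` are left over, and can only be visited one after
the other, along an edge that is present if and only if `D` belongs to the set of the player.
All of this follows from conditions on the predecessors and successors of single vertices
(`IsHamSucc.selected`), without regard to the order in which a path visits the
parts of the graph. Conversely a common pair yields a path (`exists_isDirHamPath`).

For the search problem, the players read off the directions of the rows from the outputs of their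
own vertices, and declare that the sets meet if both see the same pair and it belongs to both sets.
-/

/-! ### Few biased coordinates -/

lemma one_add_exp_neg_one_le : (1 + Real.exp (-1)) ≤ 2 * Real.exp (-1 / 3) := by
  have h3 : Real.exp (-1 / 3) ^ 3 = Real.exp (-1) := by
    rw [← Real.exp_nat_mul]; norm_num
  have h1 := Real.exp_neg_one_lt_d9
  have h2 := Real.exp_neg_one_gt_d9
  have hp := Real.exp_pos (-1 / 3)
  by_contra! hlt
  have : Real.exp (-1 / 3) < 0.69 := by linarith
  have : Real.exp (-1 / 3) ^ 3 < 0.69 ^ 3 := by gcongr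
  rw [h3] at this
  norm_num at this h2
  linarith

lemma sum_two_pow_exp_le (U : Type*) [Fintype U] :
    ∑ S : Finset U, Real.exp (Fintype.card U / 4 - S.card) ≤
      2 ^ Fintype.card U * Real.exp (-(Fintype.card U : ℝ) / 480) := by
  set K := Fintype.card U with hK
  have h1 : ∑ S : Finset U, Real.exp (-1) ^ S.card = (Real.exp (-1) + 1) ^ K := by
    rw [hK, ← Finset.card_univ, ← Finset.sum_pow_mul_eq_add_pow, Finset.powerset_univ]
    simp
  have h2 : ∑ S : Finset U, Real.exp ((K : ℝ) / 4 - S.card) =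
      Real.exp ((K : ℝ) / 4) * (Real.exp (-1) + 1) ^ K := by
    rw [← h1, Finset.mul_sum]
    refine Finset.sum_congr rfl fun S _ => ?_
    rw [← Real.exp_nat_mul, ← Real.exp_add]
    congr 1; ring
  rw [h2]
  have h3 : (Real.exp (-1) + 1) ^ K ≤ (2 * Real.exp (-1 / 3)) ^ K := by
    gcongr
    linarith [one_add_exp_neg_one_le]
  calc _ ≤ Real.exp ((K : ℝ) / 4) * (2 * Real.exp (-1 / 3)) ^ K := by gcongr
    _ = 2 ^ K * Real.exp (-(K : ℝ) / 12) := by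
        rw [mul_pow, ← Real.exp_nat_mul, mul_left_comm, ← Real.exp_add]
        congr 2; ring
    _ ≤ _ := by
        gcongr 2 ^ K * Real.exp ?_
        have : (0 : ℝ) ≤ K := by positivity
        linarith

section Disjointness

variable {U : Type*} [DecidableEq U]

/-- The number of members of the family `C` that are subsets of `S`. -/
def subCount (C : Finset (Finset U)) (S : Finset U) : ℕ := (C.filter (· ⊆ S)).card

/-- The number of members of the family `C` that are subsets of `S` and contain `i`. -/
def subCountMem (C : Finset (Finset U)) (S : Finset U) (i : U) : ℕ :=
  (C.filter fun x => x ⊆ S ∧ i ∈ x).card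

lemma subCount_eq (C : Finset (Finset U)) (S : Finset U) (i : U) :
    subCount C S = subCount C (S.erase i) + subCountMem C S i := by
  unfold subCount subCountMem
  rw [← Finset.card_union_of_disjoint]
  · congr 1
    ext x
    simp only [Finset.mem_filter, Finset.mem_union, Finset.subset_erase]
    tauto
  · rw [Finset.disjoint_left]
    intro x
    simp only [Finset.mem_filter, Finset.subset_erase]
    tauto

/-- The elements `i` of `S` such that a set drawn from the members of `C` inside `S` contains
`i` with probability less than `1 / 6` or more than `5 / 6`. -/
def biased (C : Finset (Finset U)) (S : Finset U) : Finset U :=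
  S.filter fun i => 6 * subCountMem C S i < subCount C S ∨
    6 * subCount C (S.erase i) < subCount C S

/-- A family with many biased elements is exponentially small. Each set `x` is given the weight
`exp (-N x)`, where `N x` counts the biased elements at which `x` takes the rare value: over all
subsets of `S` the weights sum to a product, and over the family their mean is at least
`exp (-(mean of N))`. -/
lemma subCount_le_of_biased (C : Finset (Finset U)) (S : Finset U) :
    (subCount C S : ℝ) ≤ 2 ^ S.card * Real.exp (-((biased C S).card : ℝ) / 6) := by
  classical
  set B := biased C S with hB
  set r : ℝ := (B.card : ℝ) with hr
  have hBS : B ⊆ S := Finset.filter_subset _ _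
  set c : ℝ := (subCount C S : ℝ) with hc
  let φ : U → ℝ := fun i => if i ∈ B ∧ 6 * subCountMem C S i < subCount C S then 1 else 0
  let ψ : U → ℝ := fun i => if i ∈ B ∧ ¬ 6 * subCountMem C S i < subCount C S then 1 else 0
  let N : Finset U → ℝ := fun x => ∑ i ∈ x, φ i + ∑ i ∈ S \ x, ψ i
  have htot : ∑ x ∈ S.powerset, Real.exp (-N x)
      = ∏ i ∈ S, (Real.exp (-φ i) + Real.exp (-ψ i)) := by
    rw [Finset.prod_add]
    refine Finset.sum_congr rfl fun x _ => ?_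
    rw [← Real.exp_sum, ← Real.exp_sum, ← Real.exp_add, Finset.sum_neg_distrib,
      Finset.sum_neg_distrib]
    congr 1
    simp only [N]
    ring
  have hprod : ∏ i ∈ S, (Real.exp (-φ i) + Real.exp (-ψ i))
      ≤ 2 ^ S.card * Real.exp (-r / 3) := by
    have h1 : ∀ i ∈ S, Real.exp (-φ i) + Real.exp (-ψ i)
        ≤ 2 * Real.exp (if i ∈ B then (-1 / 3 : ℝ) else 0) := by
      intro i _
      by_cases hi : i ∈ B
      · by_cases h6 : 6 * subCountMem C S i < subCount C S
        · simp only [φ, ψ, hi, h6, not_true_eq_false, and_false, and_true, if_true, if_false,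
            neg_zero, Real.exp_zero]
          linarith [one_add_exp_neg_one_le]
        · simp only [φ, ψ, hi, h6, not_false_eq_true, and_false, and_true, if_true, if_false,
            neg_zero, Real.exp_zero]
          linarith [one_add_exp_neg_one_le]
      · simp only [φ, ψ, hi, false_and, if_false, neg_zero, Real.exp_zero]
        norm_num
    calc _ ≤ ∏ i ∈ S, (2 * Real.exp (if i ∈ B then (-1 / 3 : ℝ) else 0)) :=
          Finset.prod_le_prod (fun i _ => by positivity) h1
      _ = _ := by
          rw [Finset.prod_mul_distrib, Finset.prod_const, ← Real.exp_sum, Finset.sum_ite_mem,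
            Finset.inter_eq_right.mpr hBS, Finset.sum_const, nsmul_eq_mul]
          congr 2
          rw [hr]; ring
  have hmean : ∑ x ∈ C.filter (· ⊆ S), N x ≤ c * (r / 6) := by
    have h1 : ∀ x ∈ C.filter (· ⊆ S), N x = ∑ i ∈ S, if i ∈ x then φ i else ψ i := by
      intro x hx
      have hxS : x ⊆ S := (Finset.mem_filter.mp hx).2
      rw [Finset.sum_ite, Finset.filter_mem_eq_inter, Finset.inter_eq_right.mpr hxS,
        ← Finset.sdiff_eq_filter]
    rw [Finset.sum_congr rfl h1, Finset.sum_comm]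
    have h2 : ∀ i ∈ S, ∑ x ∈ C.filter (· ⊆ S), (if i ∈ x then φ i else ψ i)
        ≤ if i ∈ B then c / 6 else 0 := by
      intro i _
      have h3 : ∑ x ∈ C.filter (· ⊆ S), (if i ∈ x then φ i else ψ i)
          = subCountMem C S i * φ i + subCount C (S.erase i) * ψ i := by
        rw [Finset.sum_ite, Finset.sum_const, Finset.sum_const, Finset.filter_filter,
          Finset.filter_filter, nsmul_eq_mul, nsmul_eq_mul]
        unfold subCountMem subCount
        simp only [Finset.subset_erase]
      rw [h3]
      by_cases hi : i ∈ B
      · have hi' := (Finset.mem_filter.mp hi).2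
        by_cases h6 : 6 * subCountMem C S i < subCount C S
        · simp only [φ, ψ, hi, h6, not_true_eq_false, and_false, and_true, if_true, if_false]
          have : (6 * subCountMem C S i : ℝ) < subCount C S := by exact_mod_cast h6
          linarith
        · have h7 := hi'.resolve_left h6
          simp only [φ, ψ, hi, h6, not_false_eq_true, and_false, and_true, if_true, if_false]
          have : (6 * subCount C (S.erase i) : ℝ) < subCount C S := by exact_mod_cast h7
          linarith
      · simp [φ, ψ, hi]
    refine (Finset.sum_le_sum h2).trans (le_of_eq ?_)
    rw [Finset.sum_ite_mem, Finset.inter_eq_right.mpr hBS, Finset.sum_const, nsmul_eq_mul]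
    rw [hr]; ring
  have hlow : c * Real.exp (-r / 6) ≤ ∑ x ∈ C.filter (· ⊆ S), Real.exp (-N x) := by
    have h1 : ∀ x ∈ C.filter (· ⊆ S),
        Real.exp (-r / 6) * (1 + r / 6 - N x) ≤ Real.exp (-N x) := by
      intro x _
      have h2 : Real.exp (-N x) = Real.exp (-r / 6) * Real.exp (r / 6 - N x) := by
        rw [← Real.exp_add]; congr 1; ring
      rw [h2]
      have := Real.add_one_le_exp (r / 6 - N x)
      gcongr
      linarith
    refine le_trans ?_ (Finset.sum_le_sum h1)
    rw [← Finset.mul_sum, Finset.sum_sub_distrib, Finset.sum_const, nsmul_eq_mul, mul_comm]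
    have h4 : ((C.filter (· ⊆ S)).card : ℝ) = c := rfl
    rw [h4]
    gcongr
    linarith
  have hsub : ∑ x ∈ C.filter (· ⊆ S), Real.exp (-N x) ≤ ∑ x ∈ S.powerset, Real.exp (-N x) := by
    refine Finset.sum_le_sum_of_subset_of_nonneg ?_ fun _ _ _ => (Real.exp_pos _).le
    intro x hx
    exact Finset.mem_powerset.mpr (Finset.mem_filter.mp hx).2
  have hfin : c * Real.exp (-r / 6) ≤ 2 ^ S.card * Real.exp (-r / 6) * Real.exp (-r / 6) := by
    refine (hlow.trans (hsub.trans (htot.le.trans hprod))).trans (le_of_eq ?_)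
    rw [mul_assoc, ← Real.exp_add]; congr 2; ring
  exact le_of_mul_le_mul_right hfin (Real.exp_pos _)

/-! ### Corruption of rectangles -/

lemma subCount_le_two_pow (C : Finset (Finset U)) (S : Finset U) :
    (subCount C S : ℝ) ≤ 2 ^ S.card := by
  have : subCount C S ≤ 2 ^ S.card := by
    rw [← Finset.card_powerset]
    exact Finset.card_le_card fun x hx => Finset.mem_powerset.mpr (Finset.mem_filter.mp hx).2
  exact_mod_cast this

variable [Fintype U]

/-- The elements of `S` at which the comparison of the two input distributions fails: all of them
if `S` is small or contains too few members of `C`, and the biased ones otherwise. -/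
noncomputable def exceptional (C : Finset (Finset U)) (S : Finset U) : Finset U := by
  classical exact
    if (S.card : ℝ) < Fintype.card U / 4 ∨
      (subCount C S : ℝ) < 2 ^ S.card * Real.exp (-(Fintype.card U : ℝ) / 480)
    then S else biased C S

/-- The contribution of the exceptional elements of a single set. -/
lemma sum_exceptional_le (C : Finset (Finset U)) (S : Finset U) :
    ∑ i ∈ exceptional C S, (subCount C (S.erase i) : ℝ) ≤
      1 / 3 * ∑ i ∈ S, (subCount C (S.erase i) : ℝ) +
        Fintype.card U * (2 ^ S.card * (Real.exp (-(Fintype.card U : ℝ) / 480) +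
          Real.exp (Fintype.card U / 4 - S.card))) := by
  set K : ℝ := (Fintype.card U : ℝ) with hK
  have hSK : (S.card : ℝ) ≤ K := Nat.cast_le.mpr (Finset.card_le_univ S)
  have hle : ∀ i, (subCount C (S.erase i) : ℝ) ≤ subCount C S := by
    intro i
    have := subCount_eq C S i
    exact_mod_cast (by omega : subCount C (S.erase i) ≤ subCount C S)
  have hnn : (0 : ℝ) ≤ ∑ i ∈ S, (subCount C (S.erase i) : ℝ) :=
    Finset.sum_nonneg fun _ _ => Nat.cast_nonneg _
  by_cases hl : (S.card : ℝ) < K / 4 ∨ (subCount C S : ℝ) < 2 ^ S.card * Real.exp (-K / 480)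
  · have he : exceptional C S = S := by
      unfold exceptional; rw [if_pos hl]
    rw [he]
    have h1 : (subCount C S : ℝ) ≤
        2 ^ S.card * (Real.exp (-K / 480) + Real.exp (K / 4 - S.card)) := by
      rcases hl with hl | hl
      · refine (subCount_le_two_pow C S).trans ?_
        have h2 : 1 ≤ Real.exp (K / 4 - S.card) := Real.one_le_exp (by linarith)
        have h3 := Real.exp_pos (-K / 480)
        have : (0 : ℝ) < 2 ^ S.card := by positivity
        nlinarith
      · refine hl.le.trans ?_
        gcongr
        linarith [Real.exp_pos (K / 4 - S.card)]
    have h4 : ∑ i ∈ S, (subCount C (S.erase i) : ℝ) ≤ S.card * subCount C S := by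
      refine (Finset.sum_le_sum fun i _ => hle i).trans ?_
      rw [Finset.sum_const, nsmul_eq_mul]
    have h5 : (S.card : ℝ) * subCount C S ≤
        K * (2 ^ S.card * (Real.exp (-K / 480) + Real.exp (K / 4 - S.card))) := by
      gcongr
    linarith
  · have he : exceptional C S = biased C S := by
      unfold exceptional; rw [if_neg hl]
    rw [he]
    push Not at hl
    obtain ⟨hs, hc⟩ := hl
    -- `subCount_le_of_biased` gives `|biased| ≤ 6 * K / 480 ≤ |S| / 20`, as `K / 4 ≤ |S|`.
    have hb : ((biased C S).card : ℝ) ≤ S.card / 20 := by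
      have h1 := hc.trans (subCount_le_of_biased C S)
      have h2 : Real.exp (-K / 480) ≤ Real.exp (-((biased C S).card : ℝ) / 6) :=
        le_of_mul_le_mul_left h1 (by positivity)
      rw [Real.exp_le_exp] at h2
      linarith
    have h1 : ∑ i ∈ biased C S, (subCount C (S.erase i) : ℝ) ≤ S.card / 20 * subCount C S := by
      refine (Finset.sum_le_sum fun i _ => hle i).trans ?_
      rw [Finset.sum_const, nsmul_eq_mul]
      gcongr
    have h2 : (S.card * (19 / 20)) * (subCount C S / 6 : ℝ) ≤
        ∑ i ∈ S, (subCount C (S.erase i) : ℝ) := by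
      have h3 : ∑ i ∈ S \ biased C S, (subCount C S / 6 : ℝ) ≤
          ∑ i ∈ S, (subCount C (S.erase i) : ℝ) := by
        refine (Finset.sum_le_sum (g := fun i => (subCount C (S.erase i) : ℝ)) ?_).trans
          (Finset.sum_le_sum_of_subset_of_nonneg Finset.sdiff_subset
            fun _ _ _ => Nat.cast_nonneg _)
        intro i hi
        rw [Finset.mem_sdiff, biased, Finset.mem_filter] at hi
        have h4 : subCount C S ≤ 6 * subCount C (S.erase i) := by
          by_contra h; exact hi.2 ⟨hi.1, Or.inr (by omega)⟩
        have : (subCount C S : ℝ) ≤ 6 * subCount C (S.erase i) := by exact_mod_cast h4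
        linarith
      have hBS : biased C S ⊆ S := Finset.filter_subset _ _
      rw [Finset.sum_const, nsmul_eq_mul, Finset.card_sdiff_of_subset hBS,
        Nat.cast_sub (Finset.card_le_card hBS)] at h3
      refine le_trans ?_ h3
      gcongr
      linarith
    have h6 : (0 : ℝ) ≤ K * (2 ^ S.card * (Real.exp (-K / 480) + Real.exp (K / 4 - S.card))) := by
      positivity
    have h7 : (0 : ℝ) ≤ S.card * subCount C S := by positivity
    linarith

/-- Sum of `f S i` over all sets `S` and their elements `i`. -/
def pointedSum (f : Finset U → U → ℝ) : ℝ := ∑ S : Finset U, ∑ i ∈ S, f S i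

lemma pointedSum_comm (f : Finset U → U → ℝ) :
    pointedSum f = pointedSum fun S i => f (insert i Sᶜ) i := by
  unfold pointedSum
  have h : ∀ g : Finset U → U → ℝ, ∑ S : Finset U, ∑ i ∈ S, g S i =
      ∑ i : U, ∑ S ∈ Finset.univ.filter (i ∈ ·), g S i := by
    intro g
    refine Finset.sum_comm' ?_
    simp
  rw [h, h]
  refine Finset.sum_congr rfl fun i _ => ?_
  refine Finset.sum_nbij' (fun S => insert i Sᶜ) (fun S => insert i Sᶜ) ?_ ?_ ?_ ?_ ?_
  · simp
  · simp
  all_goals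
    intro S hS
    have hS : i ∈ S := by simpa using hS
    have : insert i (insert i Sᶜ)ᶜ = S := by
      ext j
      by_cases hj : j = i <;> simp [hj, hS]
    simp only [this]

open Classical in
lemma pointedSum_exceptional_le (C D : Finset (Finset U)) :
    pointedSum (fun S i => if i ∈ exceptional C S then
        (subCount C (S.erase i) : ℝ) * subCount D Sᶜ else 0) ≤
      1 / 3 * pointedSum (fun S i => (subCount C (S.erase i) : ℝ) * subCount D Sᶜ) +
        Fintype.card U * 4 ^ Fintype.card U *
          (2 * Real.exp (-(Fintype.card U : ℝ) / 480)) := by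
  have hex : ∀ S, exceptional C S ⊆ S := by
    intro S
    unfold exceptional
    split_ifs
    · rfl
    · exact Finset.filter_subset _ _
  set K := Fintype.card U with hK
  set E := Real.exp (-(K : ℝ) / 480) with hE
  have hS : ∀ S : Finset U, ∑ i ∈ S, (if i ∈ exceptional C S then
        (subCount C (S.erase i) : ℝ) * subCount D Sᶜ else 0) ≤
      1 / 3 * ∑ i ∈ S, (subCount C (S.erase i) : ℝ) * subCount D Sᶜ +
        K * 2 ^ K * (E + Real.exp (K / 4 - S.card)) := by
    intro S
    rw [Finset.sum_ite_mem, Finset.inter_eq_right.mpr (hex S), ← Finset.sum_mul,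
      ← Finset.sum_mul]
    have h1 := sum_exceptional_le C S
    have h2 := subCount_le_two_pow D Sᶜ
    have h3 : (0 : ℝ) ≤ subCount D Sᶜ := Nat.cast_nonneg _
    have h4 : (2 : ℝ) ^ S.card * 2 ^ Sᶜ.card = 2 ^ K := by
      rw [← pow_add, Finset.card_add_card_compl]
    calc _ ≤ _ := mul_le_mul_of_nonneg_right h1 h3
      _ = 1 / 3 * ((∑ i ∈ S, (subCount C (S.erase i) : ℝ)) * subCount D Sᶜ) +
          K * (2 ^ S.card * (E + Real.exp (K / 4 - S.card))) * subCount D Sᶜ := by ring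
      _ ≤ 1 / 3 * ((∑ i ∈ S, (subCount C (S.erase i) : ℝ)) * subCount D Sᶜ) +
          K * (2 ^ S.card * (E + Real.exp (K / 4 - S.card))) * 2 ^ Sᶜ.card := by gcongr
      _ = _ := by rw [← h4]; ring
  unfold pointedSum
  refine (Finset.sum_le_sum fun S _ => hS S).trans ?_
  rw [Finset.sum_add_distrib, ← Finset.mul_sum, ← Finset.mul_sum, Finset.sum_add_distrib,
    Finset.sum_const, Finset.card_univ, Fintype.card_finset, nsmul_eq_mul]
  have h5 := sum_two_pow_exp_le U
  have h6 : (4 : ℝ) ^ K = 2 ^ K * 2 ^ K := by rw [← mul_pow]; norm_num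
  rw [h6]
  have h7 : (0 : ℝ) ≤ K * 2 ^ K := by positivity
  have h8 := mul_le_mul_of_nonneg_left h5 h7
  push_cast
  linarith

lemma insert_compl_erase {S : Finset U} {i : U} (hi : i ∈ S) : (insert i Sᶜ).erase i = Sᶜ :=
  Finset.erase_insert (by simpa using hi)

lemma compl_insert_compl {S : Finset U} {i : U} : (insert i Sᶜ)ᶜ = S.erase i := by
  ext j; simp

/-- Outside the exceptional elements the counts with and without `i` are comparable. -/
lemma subCount_erase_le_of_not_exceptional {C : Finset (Finset U)} {S : Finset U} {i : U}
    (hi : i ∈ S) (h : i ∉ exceptional C S) :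
    (subCount C (S.erase i) : ℝ) ≤ 6 * subCountMem C S i := by
  unfold exceptional at h
  split_ifs at h with hl
  · exact absurd hi h
  · have h4 : subCount C S ≤ 6 * subCountMem C S i := by
      by_contra h'; exact h (Finset.mem_filter.mpr ⟨hi, Or.inl (by omega)⟩)
    have := subCount_eq C S i
    exact_mod_cast (by omega : subCount C (S.erase i) ≤ 6 * subCountMem C S i)

/-- Razborov's corruption bound for the rectangle `C ×ˢ D`: up to an exponentially small error it
has a constant fraction of its disjoint mass as intersecting mass. -/
theorem corruption (C D : Finset (Finset U)) :
    pointedSum (fun S i => (subCount C (S.erase i) : ℝ) * subCount D Sᶜ) ≤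
      108 * pointedSum (fun S i => (subCountMem C S i : ℝ) * subCountMem D (insert i Sᶜ) i) +
        Fintype.card U * 4 ^ Fintype.card U *
          (12 * Real.exp (-(Fintype.card U : ℝ) / 480)) := by
  classical
  have h1 := pointedSum_exceptional_le C D
  have h2 := pointedSum_exceptional_le D C
  rw [pointedSum_comm, pointedSum_comm (fun S i => (subCount D (S.erase i) : ℝ) * _)] at h2
  set N0 := pointedSum (fun S i => (subCount C (S.erase i) : ℝ) * subCount D Sᶜ) with hN0
  have hN0' : pointedSum (fun S i => (subCount D ((insert i Sᶜ).erase i) : ℝ) *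
      subCount C (insert i Sᶜ)ᶜ) = N0 := by
    rw [hN0]
    refine Finset.sum_congr rfl fun S _ => Finset.sum_congr rfl fun i hi => ?_
    beta_reduce
    rw [insert_compl_erase hi, compl_insert_compl, mul_comm]
  rw [hN0'] at h2
  -- At an element that is exceptional for neither side, each of the two counts changes by a factor of
  -- at most `6`; the exceptional ones carry at most a third of the mass on each side.
  have h3 : N0 ≤ 36 * pointedSum (fun S i =>
        (subCountMem C S i : ℝ) * subCountMem D (insert i Sᶜ) i) +
      pointedSum (fun S i => if i ∈ exceptional C S then
        (subCount C (S.erase i) : ℝ) * subCount D Sᶜ else 0) +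
      pointedSum (fun S i => if i ∈ exceptional D (insert i Sᶜ) then
        (subCount D ((insert i Sᶜ).erase i) : ℝ) * subCount C (insert i Sᶜ)ᶜ else 0) := by
    rw [hN0]
    unfold pointedSum
    rw [Finset.mul_sum, ← Finset.sum_add_distrib, ← Finset.sum_add_distrib]
    refine Finset.sum_le_sum fun S _ => ?_
    rw [Finset.mul_sum, ← Finset.sum_add_distrib, ← Finset.sum_add_distrib]
    refine Finset.sum_le_sum fun i hi => ?_
    have e1 := insert_compl_erase hi
    beta_reduce
    rw [e1, compl_insert_compl]
    have p1 : (0 : ℝ) ≤ (subCountMem C S i : ℝ) * subCountMem D (insert i Sᶜ) i := by positivity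
    have p2 : (0 : ℝ) ≤ (subCount C (S.erase i) : ℝ) * subCount D Sᶜ := by positivity
    by_cases hC : i ∈ exceptional C S
    · rw [if_pos hC]
      split_ifs <;> linarith
    · by_cases hD : i ∈ exceptional D (insert i Sᶜ)
      · rw [if_pos hD, if_neg hC]; linarith
      · rw [if_neg hC, if_neg hD]
        have q1 := subCount_erase_le_of_not_exceptional hi hC
        have q2 := subCount_erase_le_of_not_exceptional (Finset.mem_insert_self i Sᶜ) hD
        rw [e1] at q2
        calc _ ≤ (6 * subCountMem C S i : ℝ) * (6 * subCountMem D (insert i Sᶜ) i) := by gcongr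
          _ = _ := by ring
  linarith

end Disjointness

/-! ### The randomized communication complexity of set disjointness -/

section PointedSum

variable {U : Type*} [Fintype U]

lemma pointedSum_mono {f g : Finset U → U → ℝ} (h : ∀ S, ∀ i ∈ S, f S i ≤ g S i) :
    pointedSum f ≤ pointedSum g :=
  Finset.sum_le_sum fun S _ => Finset.sum_le_sum fun i hi => h S i hi

lemma pointedSum_congr {f g : Finset U → U → ℝ} (h : ∀ S, ∀ i ∈ S, f S i = g S i) :
    pointedSum f = pointedSum g :=
  Finset.sum_congr rfl fun S _ => Finset.sum_congr rfl fun i hi => h S i hi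

lemma pointedSum_sum {α : Type*} [Fintype α] (f : α → Finset U → U → ℝ) :
    pointedSum (fun S i => ∑ a, f a S i) = ∑ a, pointedSum (f a) := by
  unfold pointedSum
  rw [Finset.sum_comm]
  exact Finset.sum_congr rfl fun S _ => Finset.sum_comm

lemma pointedSum_mul (f : Finset U → U → ℝ) (c : ℝ) :
    pointedSum (fun S i => f S i * c) = pointedSum f * c := by
  unfold pointedSum
  simp only [Finset.sum_mul]

end PointedSum

section Mixture

variable {U : Type*} [DecidableEq U] [Fintype U]

/-- The total mass of `Q` under the unnormalized distribution on disjoint pairs: a pointed set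
`(S, i)` is drawn, then subsets of `S.erase i` and of `Sᶜ`. -/
def disjointMass (Q : Finset U → Finset U → ℝ) : ℝ :=
  pointedSum fun S i => ∑ x with x ⊆ S.erase i, ∑ y with y ⊆ Sᶜ, Q x y

/-- The total mass of `Q` under the unnormalized distribution on intersecting pairs: a pointed set
`(S, i)` is drawn, then subsets of `S` and of `insert i Sᶜ` that contain `i`. -/
def meetingMass (Q : Finset U → Finset U → ℝ) : ℝ :=
  pointedSum fun S i => ∑ x with x ⊆ S ∧ i ∈ x, ∑ y with y ⊆ insert i Sᶜ ∧ i ∈ y, Q x y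

lemma pointedSum_const (c : ℝ) :
    pointedSum (fun (_ : Finset U) _ => c) =
      Fintype.card U * 2 ^ Fintype.card U / 2 * c := by
  have h1 : ∑ S : Finset U, (S.card : ℝ) = ∑ S : Finset U, (Sᶜ.card : ℝ) :=
    ((compl_bijective (α := Finset U)).sum_comp fun S => (S.card : ℝ)).symm
  have h2 : ∑ S : Finset U, (S.card : ℝ) + ∑ S : Finset U, (Sᶜ.card : ℝ) =
      2 ^ Fintype.card U * Fintype.card U := by
    rw [← Finset.sum_add_distrib]
    have : ∀ S : Finset U, (S.card : ℝ) + Sᶜ.card = Fintype.card U := by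
      intro S
      exact_mod_cast Finset.card_add_card_compl S
    simp only [this, Finset.sum_const, Finset.card_univ, Fintype.card_finset, nsmul_eq_mul]
    push_cast; ring
  unfold pointedSum
  simp only [Finset.sum_const, nsmul_eq_mul, ← Finset.sum_mul]
  congr 1
  linarith

lemma le_disjointMass (γ : ℝ) {Q : Finset U → Finset U → ℝ}
    (h : ∀ x y, Disjoint x y → γ ≤ Q x y) :
    Fintype.card U * 4 ^ Fintype.card U / 4 * γ ≤ disjointMass Q := by
  have h1 : pointedSum (fun (_ : Finset U) _ => (2 : ℝ) ^ Fintype.card U / 2 * γ) ≤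
      disjointMass Q := by
    refine pointedSum_mono fun S i hi => ?_
    have h2 : ∑ x with x ⊆ S.erase i, ∑ y with y ⊆ Sᶜ, γ ≤
        ∑ x with x ⊆ S.erase i, ∑ y with y ⊆ Sᶜ, Q x y := by
      refine Finset.sum_le_sum fun x hx => Finset.sum_le_sum fun y hy => h x y ?_
      rw [Finset.mem_filter] at hx hy
      have : Disjoint S Sᶜ := disjoint_compl_right
      exact this.mono (hx.2.trans (Finset.erase_subset _ _)) hy.2
    refine le_trans (le_of_eq ?_) h2
    have hf : ∀ T : Finset U, Finset.univ.filter (· ⊆ T) = T.powerset := by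
      intro T; ext; simp
    rw [hf, hf, Finset.sum_const, Finset.sum_const, Finset.card_powerset, Finset.card_powerset,
      nsmul_eq_mul, nsmul_eq_mul, ← Finset.card_add_card_compl S,
      ← Finset.card_erase_add_one hi]
    push_cast
    ring
  rw [pointedSum_const] at h1
  have h4 : (4 : ℝ) ^ Fintype.card U = 2 ^ Fintype.card U * 2 ^ Fintype.card U := by
    rw [← mul_pow]; norm_num
  rw [h4]
  linarith

lemma meetingMass_le (β : ℝ) {Q : Finset U → Finset U → ℝ}
    (h : ∀ x y, ¬ Disjoint x y → Q x y ≤ β) :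
    meetingMass Q ≤ Fintype.card U * 4 ^ Fintype.card U / 4 * β := by
  have h1 : meetingMass Q ≤
      pointedSum (fun (_ : Finset U) _ => (2 : ℝ) ^ Fintype.card U / 2 * β) := by
    refine pointedSum_mono fun S i hi => ?_
    have h2 : ∑ x with x ⊆ S ∧ i ∈ x, ∑ y with y ⊆ insert i Sᶜ ∧ i ∈ y, Q x y ≤
        ∑ x with x ⊆ S ∧ i ∈ x, ∑ y with y ⊆ insert i Sᶜ ∧ i ∈ y, β := by
      refine Finset.sum_le_sum fun x hx => Finset.sum_le_sum fun y hy => h x y ?_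
      rw [Finset.mem_filter] at hx hy
      exact Finset.not_disjoint_iff.mpr ⟨i, hx.2.2, hy.2.2⟩
    refine h2.trans (le_of_eq ?_)
    have hf : ∀ T : Finset U, i ∈ T →
        ((Finset.univ.filter fun x => x ⊆ T ∧ i ∈ x).card : ℝ) = 2 ^ (T.erase i).card := by
      intro T hT
      have e1 := subCount_eq Finset.univ T i
      have e2 : ∀ T : Finset U, subCount Finset.univ T = 2 ^ T.card := by
        intro T
        rw [← Finset.card_powerset]
        unfold subCount; congr 1; ext; simp
      rw [e2, e2, ← Finset.card_erase_add_one hT, pow_succ] at e1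
      change ((subCountMem Finset.univ T i : ℕ) : ℝ) = _
      have e3 : subCountMem Finset.univ T i = 2 ^ (T.erase i).card := by omega
      rw [e3]; push_cast; rfl
    rw [Finset.sum_const, Finset.sum_const, nsmul_eq_mul, nsmul_eq_mul, hf S hi,
      hf _ (Finset.mem_insert_self i Sᶜ), insert_compl_erase hi,
      ← Finset.card_add_card_compl S, ← Finset.card_erase_add_one hi]
    ring
  refine h1.trans (le_of_eq ?_)
  rw [pointedSum_const]
  have h4 : (4 : ℝ) ^ Fintype.card U = 2 ^ Fintype.card U * 2 ^ Fintype.card U := by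
    rw [← mul_pow]; norm_num
  rw [h4]
  ring

open Classical in
/-- A nonnegative combination of rectangles. -/
noncomputable def rectComb {α : Type*} [Fintype α] (v : α → ℝ) (A B : α → Finset (Finset U))
    (x y : Finset U) : ℝ :=
  ∑ a, if x ∈ A a ∧ y ∈ B a then v a else 0

lemma sum_filter_ite_mem (P R : Finset U → Prop) [DecidablePred P] [DecidablePred R]
    (A B : Finset (Finset U)) (c : ℝ) :
    ∑ x with P x, ∑ y with R y, (if x ∈ A ∧ y ∈ B then c else 0) =
      (A.filter P).card * (B.filter R).card * c := by
  have h1 : ∀ x y, (if x ∈ A ∧ y ∈ B then c else 0) =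
      (if x ∈ A then 1 else 0) * ((if y ∈ B then 1 else 0) * c) := by
    intro x y
    by_cases hx : x ∈ A <;> by_cases hy : y ∈ B <;> simp [hx, hy]
  simp only [h1, ← Finset.mul_sum, ← Finset.sum_mul]
  have h2 : ∀ (P : Finset U → Prop) [DecidablePred P] (A : Finset (Finset U)),
      ∑ x with P x, (if x ∈ A then (1 : ℝ) else 0) = (A.filter P).card := by
    intro P _ A
    rw [Finset.sum_ite_mem, Finset.sum_const, nsmul_eq_mul, mul_one]
    congr 2
    ext x; simp [and_comm]
  rw [h2, h2]
  ring

lemma disjointMass_rectComb {α : Type*} [Fintype α] (v : α → ℝ) (A B : α → Finset (Finset U)) :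
    disjointMass (rectComb v A B) =
      ∑ a, pointedSum (fun S i => (subCount (A a) (S.erase i) : ℝ) * subCount (B a) Sᶜ) * v a := by
  simp only [← pointedSum_mul]
  rw [← pointedSum_sum]
  refine pointedSum_congr fun S i _ => ?_
  unfold rectComb
  simp only [Finset.sum_comm (s := Finset.univ.filter _) (t := (Finset.univ : Finset α))]
  refine Finset.sum_congr rfl fun a _ => ?_
  rw [sum_filter_ite_mem]
  rfl

lemma meetingMass_rectComb {α : Type*} [Fintype α] (v : α → ℝ) (A B : α → Finset (Finset U)) :
    meetingMass (rectComb v A B) =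
      ∑ a, pointedSum (fun S i =>
        (subCountMem (A a) S i : ℝ) * subCountMem (B a) (insert i Sᶜ) i) * v a := by
  simp only [← pointedSum_mul]
  rw [← pointedSum_sum]
  refine pointedSum_congr fun S i _ => ?_
  unfold rectComb
  simp only [Finset.sum_comm (s := Finset.univ.filter _) (t := (Finset.univ : Finset α))]
  refine Finset.sum_congr rfl fun a _ => ?_
  rw [sum_filter_ite_mem]
  rfl

/-- The corruption bound for nonnegative combinations of rectangles. -/
lemma corruption_rectComb {α : Type*} [Fintype α] (v : α → ℝ) (hv : ∀ a, 0 ≤ v a)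
    (A B : α → Finset (Finset U)) :
    disjointMass (rectComb v A B) ≤ 108 * meetingMass (rectComb v A B) +
      Fintype.card U * 4 ^ Fintype.card U *
        (12 * Real.exp (-(Fintype.card U : ℝ) / 480)) * ∑ a, v a := by
  rw [disjointMass_rectComb, meetingMass_rectComb, Finset.mul_sum, Finset.mul_sum,
    ← Finset.sum_add_distrib]
  refine Finset.sum_le_sum fun a _ => ?_
  have := mul_le_mul_of_nonneg_right (corruption (A a) (B a)) (hv a)
  linarith

open Classical in
lemma rectComb_pow {α : Type*} [Fintype α] (v : α → ℝ)
    (A B : α → Finset (Finset U)) (m : ℕ) (x y : Finset U) :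
    rectComb v A B x y ^ m =
      rectComb (fun p : Fin m → α => ∏ j, v (p j))
        (fun p => Finset.univ.filter fun x => ∀ j, x ∈ A (p j))
        (fun p => Finset.univ.filter fun y => ∀ j, y ∈ B (p j)) x y := by
  unfold rectComb
  rw [Fintype.sum_pow]
  refine Finset.sum_congr rfl fun p _ => ?_
  simp only [Finset.mem_filter, Finset.mem_univ, true_and, ← forall_and]
  split_ifs with h
  · exact Finset.prod_congr rfl fun j _ => by rw [if_pos (h j)]
  · push Not at h
    obtain ⟨j, hj⟩ := h
    exact Finset.prod_eq_zero (Finset.mem_univ j) (if_neg fun h => hj h.1 h.2)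

open Classical in
/-- The randomized communication complexity of set disjointness is linear in the size of the ground
set. A deterministic protocol is represented by the function `F s` to its set `Γ` of transcripts,
whose fibres are rectangles, and by the set of transcripts after which it declares the
sets disjoint; `w` is the distribution of the protocol. The eighth power of the
probability of such a declaration is a combination of rectangles again, and it is much larger on
disjoint pairs than on intersecting ones, which contradicts corruption if `Γ` is small. -/
theorem exp_card_le_of_protocol [Nonempty U] {σ Γ : Type*} [Fintype σ] [Fintype Γ] (w : σ → ℝ)
    (hw : ∀ s, 0 ≤ w s) (hw1 : ∑ s, w s = 1) (F : σ → Finset U → Finset U → Γ)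
    (hF : ∀ s x y x' y', F s x y = F s x' y' → F s x y' = F s x y) (g : σ → Γ → Prop)
    (hdis : ∀ x y, Disjoint x y → 2 / 3 ≤ ∑ s, if g s (F s x y) then w s else 0)
    (hmeet : ∀ x y, ¬ Disjoint x y → (∑ s, if g s (F s x y) then w s else 0) ≤ 1 / 3) :
    Real.exp ((Fintype.card U : ℝ) / 480) ≤ 3000 * (Fintype.card Γ : ℝ) ^ 8 := by
  let v : σ × Γ → ℝ := fun a => if g a.1 a.2 then w a.1 else 0
  let A : σ × Γ → Finset (Finset U) := fun a => Finset.univ.filter fun x => ∃ y, F a.1 x y = a.2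
  let B : σ × Γ → Finset (Finset U) := fun a => Finset.univ.filter fun y => ∃ x, F a.1 x y = a.2
  have hv : ∀ a, 0 ≤ v a := fun a => by
    simp only [v]; split_ifs
    exacts [hw _, le_rfl]
  have hq : ∀ x y, rectComb v A B x y = ∑ s, if g s (F s x y) then w s else 0 := by
    intro x y
    unfold rectComb
    rw [Fintype.sum_prod_type]
    refine Finset.sum_congr rfl fun s _ => ?_
    have h1 : ∀ γ, (x ∈ A (s, γ) ∧ y ∈ B (s, γ)) ↔ γ = F s x y := by
      intro γ
      simp only [A, B, Finset.mem_filter, Finset.mem_univ, true_and]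
      constructor
      · rintro ⟨⟨y', h1⟩, ⟨x', h2⟩⟩
        have := hF s x y' x' y (h1.trans h2.symm)
        rw [this, h1]
      · rintro rfl
        exact ⟨⟨y, rfl⟩, ⟨x, rfl⟩⟩
    simp only [h1, Finset.sum_ite_eq', Finset.mem_univ, if_true, v]
  have hvsum : ∑ a, v a ≤ Fintype.card Γ := by
    calc ∑ a, v a ≤ ∑ a : σ × Γ, w a.1 := by
          refine Finset.sum_le_sum fun a _ => ?_
          simp only [v]; split_ifs
          exacts [le_rfl, hw _]
      _ = Fintype.card Γ := by
          rw [Fintype.sum_prod_type_right]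
          simp [hw1]
  -- The exponent `8` makes the ratio `2 ^ 8` of the two masses exceed `2 * 108`, where `108` is the
  -- constant of the corruption bound.
  have hcor := corruption_rectComb (fun p : Fin 8 → σ × Γ => ∏ j, v (p j))
    (fun p => Finset.prod_nonneg fun j _ => hv _)
    (fun p => Finset.univ.filter fun x => ∀ j, x ∈ A (p j))
    (fun p => Finset.univ.filter fun y => ∀ j, y ∈ B (p j))
  rw [← Fintype.sum_pow] at hcor
  have hpow : rectComb (fun p : Fin 8 → σ × Γ => ∏ j, v (p j))
      (fun p => Finset.univ.filter fun x => ∀ j, x ∈ A (p j))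
      (fun p => Finset.univ.filter fun y => ∀ j, y ∈ B (p j)) =
      fun x y => rectComb v A B x y ^ 8 := by
    funext x y
    exact (rectComb_pow v A B 8 x y).symm
  rw [hpow] at hcor
  have h1 := le_disjointMass ((2 / 3 : ℝ) ^ 8) (Q := fun x y => rectComb v A B x y ^ 8)
    (fun x y hxy => by
      have := hdis x y hxy
      rw [← hq] at this
      gcongr)
  have h2 := meetingMass_le ((1 / 3 : ℝ) ^ 8) (Q := fun x y => rectComb v A B x y ^ 8)
    (fun x y hxy => by
      have := hmeet x y hxy
      rw [← hq] at this
      have h0 : 0 ≤ rectComb v A B x y :=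
        Finset.sum_nonneg fun a _ => by
          split_ifs
          exacts [hv a, le_rfl]
      gcongr)
  set K : ℝ := (Fintype.card U : ℝ) with hK
  have hKpos : 0 < K := Nat.cast_pos.mpr Fintype.card_pos
  have hvs : (∑ a, v a) ^ 8 ≤ (Fintype.card Γ : ℝ) ^ 8 := by
    have : 0 ≤ ∑ a, v a := Finset.sum_nonneg fun a _ => hv a
    gcongr
  set G : ℝ := (Fintype.card Γ : ℝ) ^ 8
  set P : ℝ := K * 4 ^ Fintype.card U with hP
  have hPpos : 0 < P := by positivity
  set e := Real.exp (-K / 480) with he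
  have hepos : 0 < e := Real.exp_pos _
  have h3 : P / 4 * (2 / 3) ^ 8 ≤ 108 * (P / 4 * (1 / 3) ^ 8) + P * (12 * e) * G := by
    have : P * (12 * e) * (∑ a, v a) ^ 8 ≤ P * (12 * e) * G := by gcongr
    linarith
  have h4 : (1 : ℝ) ≤ 3000 * G * e := by
    have h5 : P * ((2 / 3) ^ 8 / 4) ≤ P * (108 * (1 / 3) ^ 8 / 4 + 12 * e * G) := by linarith
    have h6 := le_of_mul_le_mul_left h5 hPpos
    norm_num at h6
    linarith
  have h7 : Real.exp (K / 480) * e = 1 := by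
    rw [he, ← Real.exp_add]
    have : K / 480 + -K / 480 = 0 := by ring
    rw [this, Real.exp_zero]
  refine le_of_mul_le_mul_right ?_ hepos
  rw [h7]
  exact h4

end Mixture

/-! ### Two players simulate an algorithm -/

lemma message_getElem?_injective (b : ℕ) :
    Function.Injective fun (m : Message b) (i : Fin b) => m.1[(i : ℕ)]? := by
  intro m m' h
  apply Subtype.ext
  refine List.ext_getElem? fun i => ?_
  by_cases hi : i < b
  · exact congrFun h ⟨i, hi⟩
  · rw [List.getElem?_eq_none (m.2.trans (not_lt.mp hi)),
      List.getElem?_eq_none (m'.2.trans (not_lt.mp hi))]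

noncomputable instance (b : ℕ) : Fintype (Message b) :=
  @Fintype.ofFinite _ (Finite.of_injective _ (message_getElem?_injective b))

lemma card_message_le (b : ℕ) : Fintype.card (Message b) ≤ 3 ^ b := by
  simpa using Fintype.card_le_of_injective _ (message_getElem?_injective b)

/-- A family of networks whose vertices are split between two players: the neighbourhoods of the
vertices in `S` depend only on the first player's input `x`, those of the other vertices only on the
second player's input `y`, and `E` contains all ordered pairs of adjacent vertices of
different players. -/
structure IsSplitFamily {n : ℕ} {X Y : Type*} (G : X → Y → Digraph (Fin n)) (S : Set (Fin n))
    (E : Finset (Fin n × Fin n)) : Prop where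
  left : ∀ x y y', ∀ v ∈ S, ∀ w,
    ((G x y).Adj v w ↔ (G x y').Adj v w) ∧ ((G x y).Adj w v ↔ (G x y').Adj w v)
  right : ∀ x x' y, ∀ v ∉ S, ∀ w,
    ((G x y).Adj v w ↔ (G x' y).Adj v w) ∧ ((G x y).Adj w v ↔ (G x' y).Adj w v)
  cut : ∀ x y u v, (G x y).Adj u v → ¬ (u ∈ S ↔ v ∈ S) → (u, v) ∈ E ∧ (v, u) ∈ E

namespace IsSplitFamily

variable {n : ℕ} {X Y : Type*} {G : X → Y → Digraph (Fin n)} {S : Set (Fin n)}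
  {E : Finset (Fin n × Fin n)}

lemma mem_of_adj (h : IsSplitFamily G S E) {x : X} {y : Y} {u v : Fin n}
    (ha : (G x y).toSimpleGraphInclusive.Adj u v) (hS : ¬ (u ∈ S ↔ v ∈ S)) : (u, v) ∈ E := by
  rcases ha.2 with h1 | h1
  · exact (h.cut x y u v h1 hS).1
  · exact (h.cut x y v u h1 fun h2 => hS h2.symm).2

lemma adj_left (h : IsSplitFamily G S E) (x : X) (y y' : Y) {v : Fin n} (hv : v ∈ S)
    (u : Fin n) : (G x y).toSimpleGraphInclusive.Adj u v ↔
      (G x y').toSimpleGraphInclusive.Adj u v := by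
  have := h.left x y y' v hv u
  simp only [Digraph.toSimpleGraphInclusive, SimpleGraph.fromRel_adj, this.1, this.2]

lemma adj_right (h : IsSplitFamily G S E) (x x' : X) (y : Y) {v : Fin n} (hv : v ∉ S)
    (u : Fin n) : (G x y).toSimpleGraphInclusive.Adj u v ↔
      (G x' y).toSimpleGraphInclusive.Adj u v := by
  have := h.right x x' y v hv u
  simp only [Digraph.toSimpleGraphInclusive, SimpleGraph.fromRel_adj, this.1, this.2]

end IsSplitFamily

namespace CongestAlgorithm

variable {n b : ℕ} {X Y : Type*} {Out : Type}

/-- The messages that `A` sends along the pairs in `E` during the first `T` rounds. -/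
noncomputable def transcript (A : CongestAlgorithm n b Out) (G : Digraph (Fin n))
    (E : Finset (Fin n × Fin n)) (T : ℕ) : Fin T × E → Message b :=
  fun p => A.send (A.states G p.1 p.2.1.1) p.2.1.2

/-- Equal transcripts on inputs `(x, y)` and `(x', y')` make the run on `(x, y')` look to the first
player like the run on `(x, y)`, and to the second player like the run on `(x', y')`. -/
lemma states_eq_of_transcript_eq (A : CongestAlgorithm n b Out) {G : X → Y → Digraph (Fin n)}
    {S : Set (Fin n)} {E : Finset (Fin n × Fin n)} (hG : IsSplitFamily G S E) {T : ℕ}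
    {x x' : X} {y y' : Y} (h : A.transcript (G x y) E T = A.transcript (G x' y') E T) :
    ∀ t ≤ T, (∀ v ∈ S, A.states (G x y') t v = A.states (G x y) t v) ∧
      ∀ v ∉ S, A.states (G x y') t v = A.states (G x' y') t v := by
  intro t
  induction t with
  | zero =>
    intro _
    constructor
    · intro v hv
      have := hG.left x y' y v hv
      simp only [states, fun w => (this w).1, fun w => (this w).2]
    · intro v hv
      have := hG.right x x' y' v hv
      simp only [states, fun w => (this w).1, fun w => (this w).2]
  | succ t ih =>
    intro ht
    obtain ⟨ihA, ihB⟩ := ih (by omega)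
    have hmsg : ∀ u v, (u, v) ∈ E → A.send (A.states (G x y) t u) v =
        A.send (A.states (G x' y') t u) v := fun u v he =>
      congrFun h (⟨t, by omega⟩, ⟨(u, v), he⟩)
    constructor
    · intro v hv
      simp only [states]
      rw [ihA v hv]
      congr 1
      funext u
      by_cases ha : (G x y).toSimpleGraphInclusive.Adj u v
      · rw [if_pos ha, if_pos ((hG.adj_left x y' y hv u).mpr ha)]
        by_cases hu : u ∈ S
        · rw [ihA u hu]
        · rw [ihB u hu, hmsg u v (hG.mem_of_adj ha (by tauto))]
      · rw [if_neg ha, if_neg (mt (hG.adj_left x y' y hv u).mp ha)]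
    · intro v hv
      simp only [states]
      rw [ihB v hv]
      congr 1
      funext u
      by_cases ha : (G x' y').toSimpleGraphInclusive.Adj u v
      · rw [if_pos ha, if_pos ((hG.adj_right x x' y' hv u).mpr ha)]
        by_cases hu : u ∈ S
        · rw [ihA u hu, hmsg u v (hG.mem_of_adj ha (by tauto))]
        · rw [ihB u hu]
      · rw [if_neg ha, if_neg (mt (hG.adj_right x x' y' hv u).mp ha)]

lemma transcript_eq (A : CongestAlgorithm n b Out) {G : X → Y → Digraph (Fin n)}
    {S : Set (Fin n)} {E : Finset (Fin n × Fin n)} (hG : IsSplitFamily G S E) {T : ℕ}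
    {x x' : X} {y y' : Y} (h : A.transcript (G x y) E T = A.transcript (G x' y') E T) :
    A.transcript (G x y') E T = A.transcript (G x y) E T := by
  funext p
  obtain ⟨hl, hr⟩ := A.states_eq_of_transcript_eq hG h p.1 p.1.2.le
  by_cases hu : p.2.1.1 ∈ S
  · simp only [transcript, hl _ hu]
  · rw [h]
    simp only [transcript, hr _ hu]

end CongestAlgorithm

/-- With respect to finitely many events, a probability space is a finite mixture of some of its
points. -/
lemma exists_finite_mixture {Ω ι : Type*} [MeasurableSpace Ω] [Finite ι] (μ : Measure Ω)
    [IsProbabilityMeasure μ] (C : ι → Set Ω) (hC : ∀ i, MeasurableSet (C i)) :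
    ∃ (σ : Set (Set ι)) (_ : Fintype σ) (w : σ → ℝ) (p : σ → Ω), (∀ s, 0 ≤ w s) ∧ ∑ s, w s = 1 ∧
      ∀ (i : ι) [DecidablePred fun s => p s ∈ C i],
        μ.real (C i) = ∑ s, if p s ∈ C i then w s else 0 := by
  classical
  let χ : Ω → Set ι := fun ω => {i | ω ∈ C i}
  have hfin : Fintype (Set.range χ) := Fintype.ofFinite _
  let fib : Set.range χ → Set Ω := fun s => χ ⁻¹' {s.1}
  have hmeas : ∀ s, MeasurableSet (fib s) := by
    intro s
    have : fib s = ⋂ i, {ω | ω ∈ C i ↔ i ∈ s.1} := by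
      ext ω
      simp only [fib, χ, Set.mem_preimage, Set.mem_singleton_iff, Set.ext_iff, Set.mem_ofPred_eq,
        Set.mem_iInter]
    rw [this]
    refine MeasurableSet.iInter fun i => ?_
    by_cases hi : i ∈ s.1
    · simpa [hi] using hC i
    · have h : {ω | ω ∈ C i ↔ i ∈ s.1} = (C i)ᶜ := by
        ext ω; simp [hi]
      rw [h]
      exact (hC i).compl
  have hdisj : Pairwise (Function.onFun Disjoint fib) := by
    intro s t hst
    rw [Function.onFun, Set.disjoint_left]
    intro ω h1 h2
    exact hst (Subtype.ext (h1.symm.trans h2))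
  choose p hp using fun s : Set.range χ => s.2
  have hmem : ∀ (s : Set.range χ) (i : ι) (ω : Ω), ω ∈ fib s → (ω ∈ C i ↔ p s ∈ C i) := by
    intro s i ω hω
    have h1 : χ ω = χ (p s) := hω.trans (hp s).symm
    exact Set.ext_iff.mp h1 i
  have hsum : ∀ F : Finset (Set.range χ), μ.real (⋃ s ∈ F, fib s) = ∑ s ∈ F, μ.real (fib s) :=
    fun F => measureReal_biUnion_finset (fun s _ t _ hst => hdisj hst) fun s _ => hmeas s
  refine ⟨Set.range χ, hfin, fun s => μ.real (fib s), p, fun s => measureReal_nonneg, ?_, ?_⟩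
  · rw [← hsum]
    have : (⋃ s ∈ (Finset.univ : Finset (Set.range χ)), fib s) = Set.univ := by
      ext ω
      simp only [Set.mem_iUnion, Finset.mem_univ, exists_prop, true_and, Set.mem_univ, iff_true]
      exact ⟨⟨χ ω, ω, rfl⟩, rfl⟩
    rw [this, probReal_univ]
  · intro i _
    rw [← Finset.sum_filter, ← hsum]
    congr 1
    ext ω
    simp only [Set.mem_iUnion, Finset.mem_filter, Finset.mem_univ, true_and, exists_prop]
    constructor
    · intro hω
      exact ⟨⟨χ ω, ω, rfl⟩, (hmem ⟨χ ω, ω, rfl⟩ i ω rfl).mp hω, rfl⟩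
    · rintro ⟨s, h1, h2⟩
      exact (hmem s i ω h2).mpr h1

/-- Two players who hold `x` and `y` decide whether the sets meet by running an algorithm on
`G x y`. They exchange the messages on the cut, and at the end the values of `infoA` and `infoB`,
which are computed from the outputs of their own vertices; `acc` tells from these values whether
they declare that the sets meet. So the number of rounds is bounded
below by the communication complexity of disjointness. -/
theorem exp_card_le_of_solvesInRounds {U : Type*} [DecidableEq U] [Fintype U] [Nonempty U]
    {n b T : ℕ} {Out Ω : Type} [MeasurableSpace Ω] {μ : Measure Ω} [IsProbabilityMeasure μ]
    {A : Ω → CongestAlgorithm n b Out} {Correct : Digraph (Fin n) → (Fin n → Out) → Prop}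
    (hsol : SolvesInRounds μ A Correct T) {G : Finset U → Finset U → Digraph (Fin n)}
    (hin : ∀ x y, IsInputGraph (G x y)) {S : Set (Fin n)} {E : Finset (Fin n × Fin n)}
    (hG : IsSplitFamily G S E) {α β : Type*} [Fintype α] [Fintype β]
    (infoA : Finset U → (Fin n → Out) → α) (infoB : Finset U → (Fin n → Out) → β)
    (hinfoA : ∀ x o o', (∀ v ∈ S, o v = o' v) → infoA x o = infoA x o')
    (hinfoB : ∀ y o o', (∀ v ∉ S, o v = o' v) → infoB y o = infoB y o')
    (acc : α → β → Prop)
    (hdis : ∀ x y o, Disjoint x y → Correct (G x y) o → ¬ acc (infoA x o) (infoB y o))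
    (hmeet : ∀ x y o, ¬ Disjoint x y → Correct (G x y) o → acc (infoA x o) (infoB y o)) :
    Real.exp ((Fintype.card U : ℝ) / 480) ≤
      3000 * ((3 ^ b) ^ (T * E.card) * Fintype.card α * Fintype.card β : ℝ) ^ 8 := by
  classical
  obtain ⟨σ, _, w, p, hw, hw1, hmix⟩ := exists_finite_mixture μ
    (fun i : Finset U × Finset U => {ω | Correct (G i.1 i.2) ((A ω).output (G i.1 i.2) T)})
    (fun i => (hsol _ (hin i.1 i.2)).1)
  have hprob : ∀ x y, 2 / 3 ≤
      ∑ s, if Correct (G x y) ((A (p s)).output (G x y) T) then w s else 0 := by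
    intro x y
    have h1 := (hsol _ (hin x y)).2
    have h2 := hmix (x, y)
    simp only [Set.mem_ofPred_eq] at h2
    rw [← h2]
    exact h1
  let F : σ → Finset U → Finset U → (Fin T × E → Message b) × α × β := fun s x y =>
    ((A (p s)).transcript (G x y) E T, infoA x ((A (p s)).output (G x y) T),
      infoB y ((A (p s)).output (G x y) T))
  have hF : ∀ s x y x' y', F s x y = F s x' y' → F s x y' = F s x y := by
    intro s x y x' y' h
    simp only [F, Prod.mk.injEq] at h ⊢
    obtain ⟨h1, h2, h3⟩ := h
    obtain ⟨hl, hr⟩ := (A (p s)).states_eq_of_transcript_eq hG h1 T le_rfl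
    refine ⟨(A (p s)).transcript_eq hG h1, ?_, ?_⟩
    · refine hinfoA _ _ _ fun v hv => ?_
      simp only [CongestAlgorithm.output, hl v hv]
    · rw [h3]
      refine hinfoB _ _ _ fun v hv => ?_
      simp only [CongestAlgorithm.output, hr v hv]
  obtain ⟨rej, hrej⟩ : ∃ rej : (Fin T × E → Message b) × α × β → Prop,
      ∀ γ, rej γ ↔ ¬ acc γ.2.1 γ.2.2 := ⟨_, fun _ => Iff.rfl⟩
  have key := exp_card_le_of_protocol w hw hw1 F hF (fun _ => rej)
    (fun x y hxy => (hprob x y).trans (Finset.sum_le_sum fun s _ => by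
      by_cases hc : Correct (G x y) ((A (p s)).output (G x y) T)
      · rw [if_pos hc, if_pos ((hrej _).mpr (hdis x y _ hxy hc))]
      · rw [if_neg hc]; split_ifs
        exacts [hw s, le_rfl]))
    (fun x y hxy => by
      have h1 : ∑ s, (if rej (F s x y) then w s else 0) ≤
          ∑ s, (w s - if Correct (G x y) ((A (p s)).output (G x y) T) then w s else 0) := by
        refine Finset.sum_le_sum fun s _ => ?_
        by_cases hc : Correct (G x y) ((A (p s)).output (G x y) T)
        · rw [if_pos hc, if_neg fun h => (hrej _).mp h (hmeet x y _ hxy hc), sub_self]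
        · rw [if_neg hc, sub_zero]; split_ifs
          exacts [le_rfl, hw s]
      rw [Finset.sum_sub_distrib, hw1] at h1
      linarith [hprob x y])
  refine key.trans ?_
  have hcard : (Fintype.card ((Fin T × E → Message b) × α × β) : ℝ) ≤
      (3 ^ b) ^ (T * E.card) * Fintype.card α * Fintype.card β := by
    have h1 : Fintype.card ((Fin T × E → Message b) × α × β) ≤
        (3 ^ b) ^ (T * E.card) * Fintype.card α * Fintype.card β := by
      rw [Fintype.card_prod, Fintype.card_prod, Fintype.card_fun, Fintype.card_prod,
        Fintype.card_fin, Fintype.card_coe, ← mul_assoc]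
      gcongr
      exact card_message_le b
    exact_mod_cast h1
  gcongr

/-! ### The gadget graph -/

section Gadget

/-- A clause `(σ, k, i)`: the player `σ` (`false` for the first one), the coordinate `k` of
the pairs in the ground set, and the value `i` of this coordinate. -/
abbrev Clause (ℓ : ℕ) : Type := Bool × Bool × (Fin ℓ → Bool)

/-- The rows are indexed by the bits of the two coordinates of a pair. -/
abbrev RowIndex (ℓ : ℕ) : Type := Bool × Fin ℓ

/-- The number of cells in a row. -/
def rowLen (ℓ : ℕ) : ℕ := 6 * 2 ^ (ℓ + 1) + 9

lemma rowLen_mod (ℓ : ℕ) : rowLen ℓ % 3 = 0 := by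
  unfold rowLen; omega

/-- The vertices of the gadget graph. The vertices `pad a` fill up the graph to the required number
of vertices, each row is a path of cells, `out σ` is the vertex at which a path leaves the part of
player `σ`, and `enter` is the one at which it enters the part of the second player. -/
inductive Vert (ℓ m : ℕ) : Type
  | pad (a : Fin (m + 1))
  | cell (h : RowIndex ℓ) (r : Fin (rowLen ℓ))
  | clause (c : Clause ℓ)
  | out (σ : Bool)
  | enter

variable {ℓ m : ℕ}

/-- A numbering of the clauses of one player. -/
noncomputable def clauseNumber (ℓ : ℕ) : Bool × (Fin ℓ → Bool) ≃ Fin (2 ^ (ℓ + 1)) :=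
  Fintype.equivFinOfCardEq (by simp [pow_succ, mul_comm])

/-- In each row, the clause `c` is attached to the two cells `3 * gap c + 2` and `3 * gap c + 3`.
One gap is left free between the clauses of the two players, and one at the end. -/
noncomputable def gap (c : Clause ℓ) : ℕ :=
  (if c.1 then 2 ^ (ℓ + 1) + 1 else 0) + clauseNumber ℓ c.2

/-- The direction in which a path has to traverse the row `h` to be able to visit the clause `c` on
the way, if there is one: the row belongs to the coordinate of the clause, and the direction is not
the bit of the value. -/
def label (h : RowIndex ℓ) (c : Clause ℓ) : Option Bool :=
  if h.1 = c.2.1 then some (!(c.2.2 h.2)) else none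

/-- The two end cells of a row. -/
def IsPort (r : Fin (rowLen ℓ)) : Prop := r.val = 0 ∨ r.val + 1 = rowLen ℓ

/-- The arcs of the gadget graph; `X σ` is the input of player `σ`, a set of pairs. -/
def Arc (X : Bool → (Fin ℓ → Bool) → (Fin ℓ → Bool) → Prop) : Vert ℓ m → Vert ℓ m → Prop
  | .pad a, .pad b => a < b
  | .pad _, .cell _ r => IsPort r
  | .pad _, .clause c => c.1 = false
  | .cell h r, .cell h' r' =>
      (h = h' ∧ (r.val + 1 = r'.val ∨ r'.val + 1 = r.val)) ∨ (h ≠ h' ∧ IsPort r ∧ IsPort r')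
  | .cell h r, .clause c =>
      (label h c = some true ∧ r.val = 3 * gap c + 2) ∨
      (label h c = some false ∧ r.val = 3 * gap c + 3) ∨
      (IsPort r ∧ c.1 = false ∧ c.2.1 = false)
  | .clause c, .cell h r =>
      (label h c = some true ∧ r.val = 3 * gap c + 3) ∨
      (label h c = some false ∧ r.val = 3 * gap c + 2)
  | .clause c, .clause c' =>
      c.1 = c'.1 ∧ c.2.1 = false ∧ c'.2.1 = true ∧ X c.1 c.2.2 c'.2.2
  | .clause c, .out σ => c.1 = σ ∧ c.2.1 = true
  | .out σ, .enter => σ = false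
  | .enter, .clause c => c.1 = true
  | _, _ => False

lemma gap_injective : Function.Injective (gap : Clause ℓ → ℕ) := by
  rintro ⟨σ, k⟩ ⟨σ', k'⟩ h
  have h1 := (clauseNumber ℓ k).2
  have h2 := (clauseNumber ℓ k').2
  cases σ <;> cases σ' <;> simp [gap] at h
  · rw [(clauseNumber ℓ).injective (Fin.ext h)]
  · omega
  · omega
  · rw [(clauseNumber ℓ).injective (Fin.ext h)]

lemma gap_lt_of_false {c : Clause ℓ} (h : c.1 = false) : gap c < 2 ^ (ℓ + 1) := by
  simp [gap, h]

lemma gap_lt_of_true {c : Clause ℓ} (h : c.1 = true) :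
    2 ^ (ℓ + 1) + 1 ≤ gap c ∧ gap c < 2 * 2 ^ (ℓ + 1) + 1 := by
  have := (clauseNumber ℓ c.2).2
  simp only [gap, h, if_true]
  omega

lemma gap_lt (c : Clause ℓ) : gap c < 2 * 2 ^ (ℓ + 1) + 1 := by
  cases h : c.1
  · have := gap_lt_of_false h; omega
  · exact (gap_lt_of_true h).2

/-! ### A Hamiltonian path selects a common pair -/

/-- What is needed of the relation between consecutive vertices on a Hamiltonian path: it
consists of arcs, is functional and injective, has no `2`-cycles, every vertex other than
`out true` has a successor, and every vertex other than `pad 0` has a predecessor. -/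
structure IsHamSucc (X : Bool → (Fin ℓ → Bool) → (Fin ℓ → Bool) → Prop)
    (R : Vert ℓ m → Vert ℓ m → Prop) : Prop where
  arc : ∀ {u v}, R u v → Arc X u v
  right_unique : ∀ {u v w}, R u v → R u w → v = w
  left_unique : ∀ {u v w}, R u w → R v w → u = v
  asymm : ∀ {u v}, R u v → ¬ R v u
  succ : ∀ u, u ≠ .out true → ∃ v, R u v
  pred : ∀ v, v ≠ .pad 0 → ∃ u, R u v

variable {X : Bool → (Fin ℓ → Bool) → (Fin ℓ → Bool) → Prop}

/-- The cell `r` of the row `h`. -/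
abbrev cellAt (m : ℕ) (h : RowIndex ℓ) (r : ℕ) (hr : r < rowLen ℓ) : Vert ℓ m := .cell h ⟨r, hr⟩

lemma arc_cell_mod_two {h : RowIndex ℓ} {r : ℕ} {hr : r < rowLen ℓ} (h2 : r % 3 = 2)
    (hlast : r + 1 < rowLen ℓ) {u : Vert ℓ m} (ha : Arc X (cellAt m h r hr) u) :
    u = cellAt m h (r - 1) (by omega) ∨ u = cellAt m h (r + 1) hlast ∨
      ∃ c, u = .clause c ∧ label h c = some true ∧ r = 3 * gap c + 2 := by
  cases u with
  | cell h' r' =>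
    simp only [Arc, IsPort] at ha
    rcases ha with ⟨rfl, ha | ha⟩ | ⟨_, ha, _⟩
    · right; left; congr 1; exact Fin.ext ha.symm
    · left; congr 1; exact Fin.ext (by simp only; omega)
    · omega
  | clause c =>
    simp only [Arc, IsPort] at ha
    rcases ha with ha | ha | ha
    · exact Or.inr (Or.inr ⟨c, rfl, ha⟩)
    · omega
    · omega
  | _ => exact ha.elim

lemma arc_to_cell_mod_two {h : RowIndex ℓ} {r : ℕ} {hr : r < rowLen ℓ} (h2 : r % 3 = 2)
    (hlast : r + 1 < rowLen ℓ) {u : Vert ℓ m} (ha : Arc X u (cellAt m h r hr)) :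
    u = cellAt m h (r - 1) (by omega) ∨ u = cellAt m h (r + 1) hlast ∨
      ∃ c, u = .clause c ∧ label h c = some false ∧ r = 3 * gap c + 2 := by
  cases u with
  | cell h' r' =>
    simp only [Arc, IsPort] at ha
    rcases ha with ⟨rfl, ha | ha⟩ | ⟨_, _, ha⟩
    · left; congr 1; exact Fin.ext (by simp only; omega)
    · right; left; congr 1; exact Fin.ext ha.symm
    · omega
  | clause c =>
    simp only [Arc] at ha
    rcases ha with ha | ha
    · omega
    · exact Or.inr (Or.inr ⟨c, rfl, ha⟩)
  | pad a => simp only [Arc, IsPort] at ha; omega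
  | _ => exact ha.elim

lemma arc_cell_mod_zero {h : RowIndex ℓ} {r : ℕ} {hr : r < rowLen ℓ} (h2 : r % 3 = 0)
    (h0 : 0 < r) {u : Vert ℓ m} (ha : Arc X (cellAt m h r hr) u) :
    u = cellAt m h (r - 1) (by omega) ∨ (∃ hr', u = cellAt m h (r + 1) hr') ∨
      ∃ c, u = .clause c ∧ label h c = some false ∧ r = 3 * gap c + 3 := by
  have hL := rowLen_mod ℓ
  cases u with
  | cell h' r' =>
    simp only [Arc, IsPort] at ha
    rcases ha with ⟨rfl, ha | ha⟩ | ⟨_, ha, _⟩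
    · right; left; exact ⟨by omega, by congr 1; exact Fin.ext ha.symm⟩
    · left; congr 1; exact Fin.ext (by simp only; omega)
    · omega
  | clause c =>
    simp only [Arc, IsPort] at ha
    rcases ha with ha | ha | ha
    · omega
    · exact Or.inr (Or.inr ⟨c, rfl, ha⟩)
    · omega
  | _ => exact ha.elim

lemma arc_to_cell_mod_zero {h : RowIndex ℓ} {r : ℕ} {hr : r < rowLen ℓ} (h2 : r % 3 = 0)
    (h0 : 0 < r) {u : Vert ℓ m} (ha : Arc X u (cellAt m h r hr)) :
    u = cellAt m h (r - 1) (by omega) ∨ (∃ hr', u = cellAt m h (r + 1) hr') ∨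
      ∃ c, u = .clause c ∧ label h c = some true ∧ r = 3 * gap c + 3 := by
  have hL := rowLen_mod ℓ
  cases u with
  | cell h' r' =>
    simp only [Arc, IsPort] at ha
    rcases ha with ⟨rfl, ha | ha⟩ | ⟨_, _, ha⟩
    · left; congr 1; exact Fin.ext (by simp only; omega)
    · right; left; exact ⟨by omega, by congr 1; exact Fin.ext ha.symm⟩
    · omega
  | clause c =>
    simp only [Arc] at ha
    rcases ha with ha | ha
    · exact Or.inr (Or.inr ⟨c, rfl, ha⟩)
    · omega
  | pad a => simp only [Arc, IsPort] at ha; omega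
  | _ => exact ha.elim

lemma arc_cell_mod_one {h : RowIndex ℓ} {r : ℕ} {hr : r < rowLen ℓ} (h2 : r % 3 = 1)
    {u : Vert ℓ m} (ha : Arc X (cellAt m h r hr) u ∨ Arc X u (cellAt m h r hr)) :
    u = cellAt m h (r - 1) (by omega) ∨ u = cellAt m h (r + 1) (by have := rowLen_mod ℓ; omega) := by
  have hL := rowLen_mod ℓ
  cases u with
  | cell h' r' =>
    simp only [Arc, IsPort] at ha
    have : h = h' ∧ (r + 1 = r' ∨ r'.val + 1 = r) := by
      rcases ha with (⟨rfl, ha⟩ | ⟨_, ha, _⟩) | (⟨rfl, ha⟩ | ⟨_, _, ha⟩) <;>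
        first | exact ⟨rfl, by omega⟩ | (exfalso; omega)
    obtain ⟨rfl, ha | ha⟩ := this
    · right; congr 1; exact Fin.ext ha.symm
    · left; congr 1; exact Fin.ext (by simp only; omega)
  | clause c => simp only [Arc, IsPort] at ha; omega
  | pad a => simp only [Arc, IsPort, false_or] at ha; omega
  | _ => exact (or_self_iff.mp ha).elim

namespace IsHamSucc

variable {R : Vert ℓ m → Vert ℓ m → Prop}

/-- The path traverses the three cells `3 * p`, `3 * p + 1`, `3 * p + 2` of the row `h`
consecutively in one of the two directions, since the middle one has no other neighbours. -/
lemma triple (hR : IsHamSucc X R) (h : RowIndex ℓ) (p : ℕ) (hp : 3 * p + 2 < rowLen ℓ) :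
    (R (cellAt m h (3 * p) (by omega)) (cellAt m h (3 * p + 1) (by omega)) ∧
      R (cellAt m h (3 * p + 1) (by omega)) (cellAt m h (3 * p + 2) hp)) ∨
    (R (cellAt m h (3 * p + 2) hp) (cellAt m h (3 * p + 1) (by omega)) ∧
      R (cellAt m h (3 * p + 1) (by omega)) (cellAt m h (3 * p) (by omega))) := by
  obtain ⟨v, hv⟩ := hR.succ (cellAt m h (3 * p + 1) (by omega)) (by simp)
  obtain ⟨u, hu⟩ := hR.pred (cellAt m h (3 * p + 1) (by omega)) (by simp)
  have h1 := arc_cell_mod_one (by omega) (Or.inl (hR.arc hv))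
  have h2 := arc_cell_mod_one (by omega) (Or.inr (hR.arc hu))
  simp only [Nat.add_sub_cancel] at h1 h2
  rcases h1 with rfl | rfl <;> rcases h2 with rfl | rfl
  · exact absurd hu (hR.asymm hv)
  · exact Or.inr ⟨hu, hv⟩
  · exact Or.inl ⟨hu, hv⟩
  · exact absurd hu (hR.asymm hv)

/-- The path traverses the `p`-th triple of the row `h` in the direction of increasing numbers. -/
def Forward (R : Vert ℓ m → Vert ℓ m → Prop) (h : RowIndex ℓ) (p : ℕ) : Prop :=
  ∃ hp : 3 * p + 2 < rowLen ℓ,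
    R (cellAt m h (3 * p) (by omega)) (cellAt m h (3 * p + 1) (by omega))

lemma forward_spec {h : RowIndex ℓ} {p : ℕ} (hR : IsHamSucc X R)
    (hf : Forward R h p) (hp : 3 * p + 2 < rowLen ℓ) :
    R (cellAt m h (3 * p) (by omega)) (cellAt m h (3 * p + 1) (by omega)) ∧
      R (cellAt m h (3 * p + 1) (by omega)) (cellAt m h (3 * p + 2) hp) := by
  rcases hR.triple h p hp with h1 | h1
  · exact h1
  · exact absurd h1.2 (hR.asymm hf.2)

lemma backward_spec {h : RowIndex ℓ} {p : ℕ} (hR : IsHamSucc X R)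
    (hf : ¬ Forward R h p) (hp : 3 * p + 2 < rowLen ℓ) :
    R (cellAt m h (3 * p + 2) hp) (cellAt m h (3 * p + 1) (by omega)) ∧
      R (cellAt m h (3 * p + 1) (by omega)) (cellAt m h (3 * p) (by omega)) := by
  rcases hR.triple h p hp with h1 | h1
  · exact absurd ⟨hp, h1.1⟩ hf
  · exact h1

lemma cellAt_ne {h h' : RowIndex ℓ} {r r' : ℕ} {hr : r < rowLen ℓ} {hr' : r' < rowLen ℓ}
    (hne : r ≠ r') : cellAt m h r hr ≠ cellAt m h' r' hr' := by
  intro heq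
  injection heq with _ h2
  exact hne (congrArg Fin.val h2)

/-- Neighbouring triples of a row are traversed in the same direction. -/
lemma forward_succ_iff (hR : IsHamSucc X R) (h : RowIndex ℓ) (p : ℕ)
    (hp : 3 * (p + 1) + 2 < rowLen ℓ) : Forward R h p ↔ Forward R h (p + 1) := by
  have hp' : 3 * p + 2 < rowLen ℓ := by omega
  constructor
  · intro hf
    by_contra hb
    obtain ⟨f1, f2⟩ := hR.forward_spec hf hp'
    obtain ⟨b1, b2⟩ := hR.backward_spec hb hp
    obtain ⟨v, hv⟩ := hR.succ (cellAt m h (3 * p + 2) hp') (by simp)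
    obtain ⟨w, hw⟩ := hR.succ (cellAt m h (3 * (p + 1)) (by omega)) (by simp)
    rcases arc_cell_mod_two (by omega) (by omega) (hR.arc hv) with rfl | rfl | ⟨c, rfl, hc, hg⟩
    · exact hR.asymm f2 hv
    · exact cellAt_ne (by omega) (hR.left_unique hv b2)
    rcases arc_cell_mod_zero (by omega) (by omega) (hR.arc hw) with
      rfl | ⟨_, rfl⟩ | ⟨c', rfl, hc', hg'⟩
    · exact cellAt_ne (by omega) (hR.left_unique hw f2)
    · exact hR.asymm b2 hw
    · rw [gap_injective (by omega : gap c = gap c'), hc'] at hc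
      simp at hc
  · intro hf
    by_contra hb
    obtain ⟨f1, f2⟩ := hR.forward_spec hf hp
    obtain ⟨b1, b2⟩ := hR.backward_spec hb hp'
    obtain ⟨v, hv⟩ := hR.pred (cellAt m h (3 * p + 2) hp') (by simp)
    obtain ⟨w, hw⟩ := hR.pred (cellAt m h (3 * (p + 1)) (by omega)) (by simp)
    rcases arc_to_cell_mod_two (by omega) (by omega) (hR.arc hv) with rfl | rfl | ⟨c, rfl, hc, hg⟩
    · exact hR.asymm b1 hv
    · exact cellAt_ne (by omega) (hR.right_unique hv f1)
    rcases arc_to_cell_mod_zero (by omega) (by omega) (hR.arc hw) with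
      rfl | ⟨_, rfl⟩ | ⟨c', rfl, hc', hg'⟩
    · exact cellAt_ne (by omega) (hR.right_unique hw b1)
    · exact hR.asymm f1 hw
    · rw [gap_injective (by omega : gap c = gap c'), hc'] at hc
      simp at hc

lemma forward_iff_zero (hR : IsHamSucc X R) (h : RowIndex ℓ) (p : ℕ)
    (hp : 3 * p + 2 < rowLen ℓ) : Forward R h p ↔ Forward R h 0 := by
  induction p with
  | zero => rfl
  | succ p ih => rw [← hR.forward_succ_iff h p hp, ih (by omega)]

open Classical in
/-- The direction in which the path traverses the row `h`. -/
noncomputable def dir (R : Vert ℓ m → Vert ℓ m → Prop) (h : RowIndex ℓ) : Bool :=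
  decide (Forward R h 0)

/-- If the path goes from a clause to a row, then the label fits to the direction of the row, and
the path has entered the clause from the same row. -/
lemma clause_cell (hR : IsHamSucc X R) {c : Clause ℓ} {h : RowIndex ℓ} {r : Fin (rowLen ℓ)}
    (hc : R (.clause c) (.cell h r)) :
    label h c = some (dir R h) ∧ ∃ r', R (.cell h r') (.clause c) := by
  have hg := gap_lt c
  have hlt : 3 * (gap c + 1) + 2 < rowLen ℓ := by unfold rowLen; omega
  have hlt' : 3 * gap c + 2 < rowLen ℓ := by omega
  have e1 := hR.forward_iff_zero h _ hlt
  have e2 := hR.forward_iff_zero h _ hlt'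
  have ha := hR.arc hc
  simp only [Arc] at ha
  rcases ha with ⟨hl, hr⟩ | ⟨hl, hr⟩
  · have hlt0 : 3 * (gap c + 1) < rowLen ℓ := by omega
    obtain rfl : r = ⟨3 * (gap c + 1), hlt0⟩ := Fin.ext (by simp only; omega)
    have hf : Forward R h (gap c + 1) := by
      by_contra hb
      have := hR.left_unique hc (hR.backward_spec hb hlt).2
      simp at this
    refine ⟨?_, ⟨3 * gap c + 2, hlt'⟩, ?_⟩
    · simp [hl, dir, e1.mp hf]
    · have f2 := (hR.forward_spec (e2.mpr (e1.mp hf)) hlt').2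
      obtain ⟨v, hv⟩ := hR.succ (cellAt m h (3 * gap c + 2) hlt') (by simp)
      rcases arc_cell_mod_two (by omega) (by omega) (hR.arc hv) with rfl | rfl | ⟨c', rfl, _, hg'⟩
      · exact absurd hv (hR.asymm f2)
      · have := hR.left_unique hv hc
        simp at this
      · rwa [← gap_injective (by omega : gap c = gap c')] at hv
  · obtain rfl : r = ⟨3 * gap c + 2, by omega⟩ := Fin.ext (by simp only; omega)
    have hb : ¬ Forward R h (gap c) := by
      intro hf
      have := hR.left_unique hc (hR.forward_spec hf hlt').2
      simp at this
    refine ⟨?_, ⟨3 * (gap c + 1), by omega⟩, ?_⟩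
    · simp [hl, dir, mt e2.mpr hb]
    · have f2 := (hR.backward_spec (mt (fun hf => e2.mpr (e1.mp hf)) hb) hlt).2
      obtain ⟨v, hv⟩ := hR.succ (cellAt m h (3 * (gap c + 1)) (by omega)) (by simp)
      rcases arc_cell_mod_zero (by omega) (by omega) (hR.arc hv) with
        rfl | ⟨_, rfl⟩ | ⟨c', rfl, _, hg'⟩
      · have := hR.left_unique hv hc
        simp at this
      · exact absurd hv (hR.asymm f2)
      · rwa [← gap_injective (by omega : gap c = gap c')] at hv

/-- The pair whose bits are the directions of the rows belongs to the sets of both players: its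
clauses cannot be visited from the rows, so they are visited one after the other. -/
theorem selected (hR : IsHamSucc X R) (σ : Bool) :
    X σ (fun t => dir R (false, t)) (fun t => dir R (true, t)) := by
  have hno : ∀ k h r, ¬ R (.clause (σ, k, fun t => dir R (k, t))) (.cell h r) := by
    intro k h r hr
    have := (hR.clause_cell hr).1
    unfold label at this
    split_ifs at this with h1
    subst h1
    simp at this
  obtain ⟨v, hv⟩ := hR.succ (.clause (σ, false, fun t => dir R (false, t))) (by simp)
  obtain ⟨w, hw⟩ := hR.succ (.clause (σ, true, fun t => dir R (true, t))) (by simp)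
  have hw' : w = .out σ := by
    cases w with
    | cell h r => exact absurd hw (hno _ _ _)
    | clause c => have := hR.arc hw; simp [Arc] at this
    | out τ => have := hR.arc hw; simp only [Arc] at this; rw [this.1]
    | _ => exact (hR.arc hw).elim
  subst hw'
  cases v with
  | cell h r => exact absurd hv (hno _ _ _)
  | clause c =>
    obtain ⟨τ, k, j⟩ := c
    have ha := hR.arc hv
    simp only [Arc, true_and] at ha
    obtain ⟨rfl, rfl, ha⟩ := ha
    obtain ⟨u, hu⟩ := hR.succ (.clause (σ, true, j)) (by simp)
    have hu' : u = .out σ := by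
      cases u with
      | cell h r =>
        obtain ⟨r', hr'⟩ := (hR.clause_cell hu).2
        have := hR.left_unique hr' hv
        simp at this
      | clause c => have := hR.arc hu; simp [Arc] at this
      | out τ => have := hR.arc hu; simp only [Arc] at this; rw [this.1]
      | _ => exact (hR.arc hu).elim
    subst hu'
    have := hR.left_unique hu hw
    simp only [Vert.clause.injEq, Prod.mk.injEq, true_and] at this
    rwa [this] at ha
  | out τ => have := hR.arc hv; simp [Arc] at this
  | _ => exact (hR.arc hv).elim

end IsHamSucc

end Gadget

/-! ### The gadget graph as a network -/

section Network

variable {ℓ m n : ℕ}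

/-- The gadget graph on the vertex set `Fin n`. -/
def gadgetGraph (e : Vert ℓ m ≃ Fin n) (X : Bool → (Fin ℓ → Bool) → (Fin ℓ → Bool) → Prop) :
    Digraph (Fin n) :=
  ⟨fun u v => Arc X (e.symm u) (e.symm v)⟩

variable {X X' : Bool → (Fin ℓ → Bool) → (Fin ℓ → Bool) → Prop}

lemma not_arc_out_true (u : Vert ℓ m) : ¬ Arc X (.out true) u := by
  cases u <;> simp [Arc]

lemma not_arc_pad_zero (u : Vert ℓ m) : ¬ Arc X u (.pad 0) := by
  cases u <;> simp [Arc]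

lemma not_arc_self (u : Vert ℓ m) : ¬ Arc X u u := by
  cases u <;> simp [Arc]
  grind

lemma isHamSucc_of_isDirHamPath {e : Vert ℓ m ≃ Fin n} {l : List (Fin n)}
    (hl : IsDirHamPath (gadgetGraph e X) l) :
    IsHamSucc X fun u v => ∃ (i : ℕ) (hi : i + 1 < l.length), l[i] = e u ∧ l[i + 1] = e v := by
  obtain ⟨hnd, hall, hch⟩ := hl
  have hidx : ∀ u, ∃ (i : ℕ) (hi : i < l.length), l[i] = e u := fun u =>
    List.getElem_of_mem (hall (e u))
  have harc : ∀ i (hi : i + 1 < l.length), Arc X (e.symm l[i]) (e.symm l[i + 1]) :=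
    List.isChain_iff_getElem.mp hch
  refine ⟨?_, ?_, ?_, ?_, ?_, ?_⟩
  · rintro u v ⟨i, hi, h1, h2⟩
    have := harc i hi
    rwa [h1, h2, e.symm_apply_apply, e.symm_apply_apply] at this
  · rintro u v w ⟨i, hi, h1, h2⟩ ⟨j, hj, h3, h4⟩
    have hij := (hnd.getElem_inj_iff).mp (h1.trans h3.symm)
    subst hij
    exact e.injective (h2.symm.trans h4)
  · rintro u v w ⟨i, hi, h1, h2⟩ ⟨j, hj, h3, h4⟩
    have hij := (hnd.getElem_inj_iff).mp (h2.trans h4.symm)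
    obtain rfl : i = j := by omega
    exact e.injective (h1.symm.trans h3)
  · rintro u v ⟨i, hi, h1, h2⟩ ⟨j, hj, h3, h4⟩
    have h5 := (hnd.getElem_inj_iff).mp (h1.trans h4.symm)
    have h6 := (hnd.getElem_inj_iff).mp (h2.trans h3.symm)
    omega
  · intro u hu
    obtain ⟨i, hi, h1⟩ := hidx u
    obtain ⟨j, hj, h2⟩ := hidx (.out true)
    by_cases hj' : j + 1 < l.length
    · have := harc j hj'
      rw [h2, e.symm_apply_apply] at this
      exact absurd this (not_arc_out_true _)
    by_cases hi' : i + 1 < l.length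
    · exact ⟨e.symm l[i + 1], i, hi', h1, by simp⟩
    · obtain rfl : i = j := by omega
      exact absurd (e.injective (h1.symm.trans h2)) hu
  · intro u hu
    obtain ⟨i, hi, h1⟩ := hidx u
    obtain ⟨j, hj, h2⟩ := hidx (.pad 0)
    have hj' : j = 0 := by
      by_contra h0
      obtain ⟨k, rfl⟩ := Nat.exists_eq_succ_of_ne_zero h0
      have := harc k hj
      simp only [Nat.succ_eq_add_one] at h2
      rw [h2, e.symm_apply_apply] at this
      exact not_arc_pad_zero _ this
    subst hj'
    by_cases hi' : i = 0
    · subst hi'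
      exact absurd (e.injective (h1.symm.trans h2)) hu
    · obtain ⟨k, rfl⟩ := Nat.exists_eq_succ_of_ne_zero hi'
      exact ⟨e.symm l[k], k, hi, by simp, h1⟩

lemma isInputGraph_gadgetGraph (e : Vert ℓ m ≃ Fin n) : IsInputGraph (gadgetGraph e X) := by
  refine ⟨fun v => not_arc_self _, ?_⟩
  set G := (gadgetGraph e X).toSimpleGraphInclusive with hG
  have hadj : ∀ u v, Arc X u v → G.Adj (e u) (e v) := by
    intro u v huv
    refine ⟨?_, Or.inl ?_⟩
    · rintro heq
      rw [e.injective heq] at huv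
      exact not_arc_self _ huv
    · simpa [gadgetGraph] using huv
  have hr : ∀ u v, Arc X u v → G.Reachable (e u) (e v) := fun u v h => (hadj u v h).reachable
  have hpad : ∀ a, G.Reachable (e (.pad 0)) (e (.pad a)) := by
    intro a
    by_cases ha : a = 0
    · rw [ha]
    · exact hr _ _ (Fin.pos_of_ne_zero ha)
  have hcell : ∀ h r (hrl : r < rowLen ℓ), G.Reachable (e (.pad 0)) (e (cellAt m h r hrl)) := by
    intro h r
    induction r with
    | zero => intro hrl; exact hr _ _ (Or.inl rfl)
    | succ r ih =>
      intro hrl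
      exact (ih (by omega)).trans (hr _ _ (Or.inl ⟨rfl, Or.inl rfl⟩))
  have hcl : ∀ k, G.Reachable (e (.pad 0)) (e (.clause (false, k))) := fun k =>
    hr _ _ (show false = false from rfl)
  have hof : G.Reachable (e (.pad 0)) (e (.out false)) :=
    (hcl (true, fun _ => true)).trans (hr _ _ ⟨rfl, rfl⟩)
  have hen : G.Reachable (e (.pad 0)) (e .enter) :=
    hof.trans (hr _ _ (show false = false from rfl))
  have hcl' : ∀ k, G.Reachable (e (.pad 0)) (e (.clause (true, k))) := fun k =>
    hen.trans (hr _ _ (show true = true from rfl))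
  have hall : ∀ v, G.Reachable (e (.pad 0)) (e v) := by
    rintro (a | ⟨h, r⟩ | ⟨σ, k⟩ | σ | _)
    · exact hpad a
    · exact hcell h r.1 r.2
    · cases σ
      exacts [hcl k, hcl' k]
    · cases σ
      exacts [hof, (hcl' (true, fun _ => true)).trans (hr _ _ ⟨rfl, rfl⟩)]
    · exact hen
  refine (SimpleGraph.connected_iff_exists_forall_reachable G).mpr ⟨e (.pad 0), fun v => ?_⟩
  simpa using hall (e.symm v)

/-- The player who simulates a vertex. Each row is cut twice, so that both of its ends belong to
the first player. -/
def side : Vert ℓ m → Bool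
  | .pad _ => false
  | .cell _ r => decide (3 * 2 ^ (ℓ + 1) + 3 ≤ r.val ∧ r.val < 6 * 2 ^ (ℓ + 1) + 6)
  | .clause c => c.1
  | .out σ => σ
  | .enter => true

/-- The arcs between vertices of different players: two for each row, and the one from
`out false` to `enter`. -/
def cutArc : Option (RowIndex ℓ × Bool) → Vert ℓ m × Vert ℓ m
  | none => (.out false, .enter)
  | some (h, false) => (cellAt m h (3 * 2 ^ (ℓ + 1) + 2) (by unfold rowLen; omega),
      cellAt m h (3 * 2 ^ (ℓ + 1) + 3) (by unfold rowLen; omega))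
  | some (h, true) => (cellAt m h (6 * 2 ^ (ℓ + 1) + 5) (by unfold rowLen; omega),
      cellAt m h (6 * 2 ^ (ℓ + 1) + 6) (by unfold rowLen; omega))

lemma exists_cutArc {u v : Vert ℓ m} (ha : Arc X u v) (hs : side u ≠ side v) :
    ∃ k, cutArc k = (u, v) ∨ cutArc k = (v, u) := by
  cases u with
  | pad a =>
    cases v with
    | cell h r =>
      simp only [Arc, IsPort, rowLen] at ha
      replace hs := hs.symm
      simp only [side, ne_eq, decide_eq_false_iff_not, not_not] at hs
      omega
    | clause c => exact absurd ha.symm hs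
    | pad b => exact absurd rfl hs
    | _ => exact ha.elim
  | cell h r =>
    cases v with
    | cell h' r' =>
      simp only [Arc, IsPort] at ha
      simp only [side, ne_eq, decide_eq_decide] at hs
      rcases ha with ⟨rfl, ha⟩ | ⟨_, h1, h2⟩
      · have h3 : (r.val = 3 * 2 ^ (ℓ + 1) + 2 ∧ r'.val = 3 * 2 ^ (ℓ + 1) + 3) ∨
            (r'.val = 3 * 2 ^ (ℓ + 1) + 2 ∧ r.val = 3 * 2 ^ (ℓ + 1) + 3) ∨
            (r.val = 6 * 2 ^ (ℓ + 1) + 5 ∧ r'.val = 6 * 2 ^ (ℓ + 1) + 6) ∨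
            (r'.val = 6 * 2 ^ (ℓ + 1) + 5 ∧ r.val = 6 * 2 ^ (ℓ + 1) + 6) := by omega
        obtain ⟨r, hr⟩ := r
        obtain ⟨r', hr'⟩ := r'
        simp only at h3
        rcases h3 with ⟨rfl, rfl⟩ | ⟨rfl, rfl⟩ | ⟨rfl, rfl⟩ | ⟨rfl, rfl⟩
        · exact ⟨some (h, false), Or.inl rfl⟩
        · exact ⟨some (h, false), Or.inr rfl⟩
        · exact ⟨some (h, true), Or.inl rfl⟩
        · exact ⟨some (h, true), Or.inr rfl⟩
      · unfold rowLen at h1 h2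
        omega
    | clause c =>
      simp only [Arc, IsPort, rowLen] at ha
      exfalso
      cases hc : c.1
      · have := gap_lt_of_false hc
        simp only [side, hc, ne_eq, decide_eq_false_iff_not, not_not] at hs
        omega
      · have := gap_lt_of_true hc
        simp only [side, hc, ne_eq, decide_eq_true_eq] at hs
        simp only [hc, Bool.true_eq_false, false_and, and_false, or_false] at ha
        omega
    | _ => exact ha.elim
  | clause c =>
    cases v with
    | cell h r =>
      simp only [Arc] at ha
      exfalso
      cases hc : c.1
      · have := gap_lt_of_false hc
        replace hs := hs.symm
        simp only [side, hc, ne_eq, decide_eq_false_iff_not, not_not] at hs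
        omega
      · have := gap_lt_of_true hc
        replace hs := hs.symm
        simp only [side, hc, ne_eq, decide_eq_true_eq] at hs
        omega
    | clause c' => exact absurd ha.1 hs
    | out σ => exact absurd ha.1 hs
    | _ => exact ha.elim
  | out σ =>
    cases v with
    | enter => obtain rfl : σ = false := ha; exact ⟨none, Or.inl rfl⟩
    | _ => exact ha.elim
  | enter =>
    cases v with
    | clause c => exact absurd (Eq.symm ha) hs
    | _ => exact ha.elim

lemma arc_congr_left {u : Vert ℓ m} (h : X (side u) = X' (side u)) (v : Vert ℓ m) :
    Arc X u v ↔ Arc X' u v := by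
  cases u <;> cases v <;> simp only [Arc]
  simp only [side] at h
  rw [h]

lemma arc_congr_right {v : Vert ℓ m} (h : X (side v) = X' (side v)) (u : Vert ℓ m) :
    Arc X u v ↔ Arc X' u v := by
  cases u <;> cases v <;> simp only [Arc]
  simp only [side] at h
  refine and_congr_right fun h1 => ?_
  rw [h1, h]

/-- The inputs of the two players, as relations. -/
def pairInput (x y : Finset ((Fin ℓ → Bool) × (Fin ℓ → Bool))) (σ : Bool)
    (i j : Fin ℓ → Bool) : Prop :=
  (i, j) ∈ if σ then y else x

open Classical in
/-- The ordered pairs of adjacent vertices of different players. -/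
noncomputable def cutPairs (e : Vert ℓ m ≃ Fin n) : Finset (Fin n × Fin n) :=
  (Finset.univ.image fun k => (e (cutArc k).1, e (cutArc k).2)) ∪
    Finset.univ.image fun k => (e (cutArc k).2, e (cutArc k).1)

lemma card_cutPairs_le (e : Vert ℓ m ≃ Fin n) : (cutPairs e).card ≤ 8 * ℓ + 2 := by
  refine (Finset.card_union_le _ _).trans
    ((add_le_add Finset.card_image_le Finset.card_image_le).trans (le_of_eq ?_))
  simp only [Finset.card_univ, Fintype.card_option, Fintype.card_prod, Fintype.card_bool,
    Fintype.card_fin]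
  ring

lemma isSplitFamily_gadgetGraph (e : Vert ℓ m ≃ Fin n) :
    IsSplitFamily (fun x y => gadgetGraph e (pairInput x y)) {v | side (e.symm v) = false}
      (cutPairs e) := by
  refine ⟨fun x y y' v hv w => ?_, fun x x' y v hv w => ?_, fun x y u v ha hS => ?_⟩
  · have h1 : pairInput x y (side (e.symm v)) = pairInput x y' (side (e.symm v)) := by
      rw [show side (e.symm v) = false from hv]; rfl
    exact ⟨arc_congr_left h1 _, arc_congr_right h1 _⟩
  · have h1 : pairInput x y (side (e.symm v)) = pairInput x' y (side (e.symm v)) := by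
      rw [Bool.eq_true_of_not_eq_false hv]; rfl
    exact ⟨arc_congr_left h1 _, arc_congr_right h1 _⟩
  · have hs : side (e.symm u) ≠ side (e.symm v) := fun h => hS (by
      simp only [Set.mem_ofPred_eq, h])
    obtain ⟨k, hk⟩ := exists_cutArc ha hs
    simp only [cutPairs, Finset.mem_union, Finset.mem_image, Finset.mem_univ, true_and]
    rcases hk with hk | hk
    · exact ⟨Or.inl ⟨k, by simp [hk]⟩, Or.inr ⟨k, by simp [hk]⟩⟩
    · exact ⟨Or.inr ⟨k, by simp [hk]⟩, Or.inl ⟨k, by simp [hk]⟩⟩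

/-- The vertex type as a sum of its constructors. -/
def vertEquiv (ℓ m : ℕ) : Vert ℓ m ≃
    Fin (m + 1) ⊕ (RowIndex ℓ × Fin (rowLen ℓ)) ⊕ Clause ℓ ⊕ Bool ⊕ Unit where
  toFun
    | .pad a => .inl a
    | .cell h r => .inr (.inl (h, r))
    | .clause c => .inr (.inr (.inl c))
    | .out σ => .inr (.inr (.inr (.inl σ)))
    | .enter => .inr (.inr (.inr (.inr ())))
  invFun
    | .inl a => .pad a
    | .inr (.inl (h, r)) => .cell h r
    | .inr (.inr (.inl c)) => .clause c
    | .inr (.inr (.inr (.inl σ))) => .out σ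
    | .inr (.inr (.inr (.inr _))) => .enter
  left_inv := by rintro (_ | _ | _ | _ | _) <;> rfl
  right_inv := by rintro (_ | _ | _ | _ | _) <;> rfl

/-- Every sufficiently large number of vertices is attained by a suitable amount of padding. -/
lemma exists_vert_equiv (hℓ : 1 ≤ ℓ) (hn : 42 * (ℓ * 2 ^ ℓ) ≤ n) :
    ∃ m, Nonempty (Vert ℓ m ≃ Fin n) := by
  have h2 : 2 ^ ℓ ≤ ℓ * 2 ^ ℓ := Nat.le_mul_of_pos_left _ hℓ
  have h3 : 2 * ℓ ≤ ℓ * 2 ^ ℓ := by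
    rw [mul_comm]
    exact Nat.mul_le_mul_left ℓ (by
      calc 2 = 2 ^ 1 := rfl
        _ ≤ 2 ^ ℓ := Nat.pow_le_pow_right (by norm_num) hℓ)
  have h4 : 2 * ℓ * rowLen ℓ = 24 * (ℓ * 2 ^ ℓ) + 18 * ℓ := by
    unfold rowLen; ring
  have h5 : 2 * ℓ * rowLen ℓ + 4 * 2 ^ ℓ + 4 ≤ n := by
    have : 2 ≤ ℓ * 2 ^ ℓ := by omega
    omega
  refine ⟨n - (2 * ℓ * rowLen ℓ + 4 * 2 ^ ℓ + 4), ⟨(vertEquiv ℓ _).trans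
    (Fintype.equivFinOfCardEq ?_)⟩⟩
  simp only [Fintype.card_sum, Fintype.card_prod, Fintype.card_bool, Fintype.card_fin,
    Fintype.card_unit, Fintype.card_fun]
  omega

end Network

/-! ### A common pair yields a Hamiltonian path -/

section Construction

variable {ℓ m n : ℕ}

open Classical in
/-- The row from which the clause `c` is visited if the pair with coordinates `D false` and `D true`
is selected: the row of some bit in which the value of the clause differs from the selected one.
The clauses of the selected values have none. -/
noncomputable def visitRow (D : Bool → Fin ℓ → Bool) (c : Clause ℓ) : Option (RowIndex ℓ) :=
  if h : ∃ t, c.2.2 t ≠ D c.2.1 t then some (c.2.1, h.choose) else none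

lemma label_of_visitRow {D : Bool → Fin ℓ → Bool} {c : Clause ℓ} {h : RowIndex ℓ}
    (hc : visitRow D c = some h) : label h c = some (D h.1 h.2) := by
  unfold visitRow at hc
  split_ifs at hc with hex
  have h1 := hex.choose_spec
  obtain rfl := Option.some_injective _ hc
  simp only [label, if_true, Option.some.injEq]
  cases h2 : D c.2.1 hex.choose <;> simp_all

lemma visitRow_eq_none_iff {D : Bool → Fin ℓ → Bool} {c : Clause ℓ} :
    visitRow D c = none ↔ c.2.2 = D c.2.1 := by
  unfold visitRow
  split_ifs with hex
  · simp only [false_iff]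
    rintro h
    obtain ⟨t, ht⟩ := hex
    exact ht (congrFun h t)
  · simp only [true_iff]
    push Not at hex
    exact funext hex

open Classical in
/-- The clause that is visited between the cells `r` and `r + 1` of the row `h`. -/
noncomputable def visitAt (D : Bool → Fin ℓ → Bool) (h : RowIndex ℓ) (r : ℕ) :
    Option (Clause ℓ) :=
  if hex : ∃ c, visitRow D c = some h ∧ 3 * gap c + 2 = r then some hex.choose else none

lemma visitAt_eq_some_iff {D : Bool → Fin ℓ → Bool} {h : RowIndex ℓ} {r : ℕ} {c : Clause ℓ} :
    visitAt D h r = some c ↔ visitRow D c = some h ∧ 3 * gap c + 2 = r := by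
  unfold visitAt
  split_ifs with hex
  · have h1 := hex.choose_spec
    constructor
    · intro h2
      rwa [← Option.some_injective _ h2]
    · intro h2
      rw [gap_injective (by omega : gap hex.choose = gap c)]
  · simp only [false_iff]
    exact fun h2 => hex ⟨c, h2⟩

/-- A cell, followed by the clause that is visited after it. -/
noncomputable def cellBlock (m : ℕ) (D : Bool → Fin ℓ → Bool) (h : RowIndex ℓ)
    (r : Fin (rowLen ℓ)) : List (Vert ℓ m) :=
  .cell h r :: (visitAt D h r).toList.map .clause

/-- The row `h` in the order of increasing numbers, with the clauses that are visited from it. -/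
noncomputable def rowList (m : ℕ) (D : Bool → Fin ℓ → Bool) (h : RowIndex ℓ) :
    List (Vert ℓ m) :=
  (List.finRange (rowLen ℓ)).flatMap (cellBlock m D h)

lemma mem_cellBlock {D : Bool → Fin ℓ → Bool} {h : RowIndex ℓ} {r : Fin (rowLen ℓ)}
    {v : Vert ℓ m} : v ∈ cellBlock m D h r ↔
      v = .cell h r ∨ ∃ c, v = .clause c ∧ visitRow D c = some h ∧ 3 * gap c + 2 = r := by
  simp only [cellBlock, List.mem_cons, List.mem_map, Option.mem_toList,
    visitAt_eq_some_iff]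
  grind

lemma nodup_rowList (D : Bool → Fin ℓ → Bool) (h : RowIndex ℓ) : (rowList m D h).Nodup := by
  refine List.nodup_flatMap.mpr ⟨fun r _ => ?_, ?_⟩
  · unfold cellBlock
    cases visitAt D h r <;> simp
  · refine (List.nodup_finRange _).imp fun {r r'} hne => ?_
    rw [Function.onFun, List.disjoint_left]
    intro v h1 h2
    rw [mem_cellBlock] at h1 h2
    rcases h1 with rfl | ⟨c, rfl, _, hc⟩ <;> rcases h2 with h2 | ⟨c', h2, _, hc'⟩
    · injection h2 with _ h3
      exact hne h3
    · simp at h2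
    · simp at h2
    · injection h2 with h3
      subst h3
      exact hne (Fin.ext (by omega))

lemma visitAt_last (D : Bool → Fin ℓ → Bool) (h : RowIndex ℓ) :
    visitAt D h (6 * 2 ^ (ℓ + 1) + 8) = none := by
  rw [Option.eq_none_iff_forall_ne_some]
  intro c hc
  have h1 := (visitAt_eq_some_iff.mp hc).2
  have h2 := gap_lt c
  omega

lemma head?_flatMap_finRange {α : Type*} {L k : ℕ} (hL : L = k + 1) (f : Fin L → List α) {x : α}
    {t : List α} (hx : f ⟨0, by omega⟩ = x :: t) :
    ((List.finRange L).flatMap f).head? = some x := by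
  subst hL
  rw [List.finRange_succ, List.flatMap_cons]
  change (f ⟨0, _⟩ ++ _).head? = _
  rw [hx, List.cons_append, List.head?_cons]

lemma getLast?_flatMap_finRange {α : Type*} {L k : ℕ} (hL : L = k + 1) (f : Fin L → List α)
    {x : α} (hx : f ⟨k, by omega⟩ = [x]) :
    ((List.finRange L).flatMap f).getLast? = some x := by
  subst hL
  rw [List.finRange_succ_last, List.flatMap_append, List.flatMap_singleton, List.getLast?_append]
  change ((f ⟨k, _⟩).getLast?.or _) = _
  rw [hx]
  rfl

lemma head?_rowList (D : Bool → Fin ℓ → Bool) (h : RowIndex ℓ) :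
    (rowList m D h).head? = some (cellAt m h 0 (by unfold rowLen; omega)) :=
  head?_flatMap_finRange (k := 6 * 2 ^ (ℓ + 1) + 8) rfl _ rfl

lemma getLast?_rowList (D : Bool → Fin ℓ → Bool) (h : RowIndex ℓ) :
    (rowList m D h).getLast? =
      some (cellAt m h (6 * 2 ^ (ℓ + 1) + 8) (by unfold rowLen; omega)) :=
  getLast?_flatMap_finRange (k := 6 * 2 ^ (ℓ + 1) + 8) rfl _
    (by simp only [cellBlock, visitAt_last, Option.toList_none, List.map_nil]; rfl)

variable {X : Bool → (Fin ℓ → Bool) → (Fin ℓ → Bool) → Prop}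

/-- The row is a path in the direction given by the selected bit. -/
lemma isChain_rowList (D : Bool → Fin ℓ → Bool) (h : RowIndex ℓ) :
    (rowList m D h).IsChain fun u v => if D h.1 h.2 then Arc X u v else Arc X v u := by
  have hne : [] ∉ (List.finRange (rowLen ℓ)).map (cellBlock m D h) := by
    simp [cellBlock]
  rw [rowList, List.flatMap_def, List.isChain_flatten hne]
  constructor
  · intro l hl
    obtain ⟨r, _, rfl⟩ := List.mem_map.mp hl
    unfold cellBlock
    cases hv : visitAt D h r with
    | none => simp
    | some c =>
      obtain ⟨h1, h2⟩ := visitAt_eq_some_iff.mp hv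
      have h3 := label_of_visitRow h1
      simp only [Option.toList_some, List.map_cons, List.map_nil, List.isChain_pair]
      cases hd : D h.1 h.2
      · rw [hd] at h3
        exact Or.inr ⟨h3, h2.symm⟩
      · rw [hd] at h3
        exact Or.inl ⟨h3, h2.symm⟩
  · rw [List.isChain_map, List.isChain_iff_getElem]
    intro i hi x hx y hy
    rw [List.length_finRange] at hi
    simp only [List.getElem_finRange, Fin.cast_mk] at hx hy
    have hy' : y = cellAt m h (i + 1) hi := by
      simp only [cellBlock, List.head?_cons, Option.mem_def, Option.some.injEq] at hy
      exact hy.symm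
    subst hy'
    rcases mem_cellBlock.mp (List.mem_of_mem_getLast? hx) with rfl | ⟨c, rfl, h1, h2⟩
    · cases D h.1 h.2
      · exact Or.inl ⟨rfl, Or.inr rfl⟩
      · exact Or.inl ⟨rfl, Or.inl rfl⟩
    · have h3 := label_of_visitRow h1
      simp only at h2
      cases hd : D h.1 h.2
      · rw [hd] at h3
        exact Or.inr (Or.inl ⟨h3, by simp only; omega⟩)
      · rw [hd] at h3
        exact Or.inl ⟨h3, by simp only; omega⟩

/-- The blocks of the Hamiltonian path: the padding, the rows, and the final segment through the
clauses of the selected pair. -/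
noncomputable def block (m : ℕ) (D : Bool → Fin ℓ → Bool) :
    Option (Option (RowIndex ℓ)) → List (Vert ℓ m)
  | none => (List.finRange (m + 1)).map .pad
  | some (some h) => if D h.1 h.2 then rowList m D h else (rowList m D h).reverse
  | some none => [.clause (false, false, D false), .clause (false, true, D true), .out false,
      .enter, .clause (true, false, D false), .clause (true, true, D true), .out true]

/-- The block that contains a vertex. -/
noncomputable def blockIndex (D : Bool → Fin ℓ → Bool) : Vert ℓ m → Option (Option (RowIndex ℓ))
  | .pad _ => none
  | .cell h _ => some (some h)
  | .clause c => some (visitRow D c)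
  | .out _ => some none
  | .enter => some none

/-- The order of the blocks. -/
noncomputable def blockOrder (ℓ : ℕ) : List (Option (Option (RowIndex ℓ))) :=
  none :: ((Finset.univ : Finset (RowIndex ℓ)).toList.map (fun h => some (some h)) ++ [some none])

lemma mem_blockOrder (k : Option (Option (RowIndex ℓ))) : k ∈ blockOrder ℓ := by
  rcases k with _ | _ | h <;> simp [blockOrder]

lemma nodup_blockOrder (ℓ : ℕ) : (blockOrder ℓ).Nodup := by
  unfold blockOrder
  rw [List.nodup_cons, List.nodup_append]
  refine ⟨by simp, ?_, by simp, by grind⟩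
  exact (Finset.nodup_toList _).map fun a b h => by simpa using h

lemma mem_block_some_some {D : Bool → Fin ℓ → Bool} {h : RowIndex ℓ} {v : Vert ℓ m} :
    v ∈ block m D (some (some h)) ↔ (∃ r, v = .cell h r) ∨
      ∃ c, v = .clause c ∧ visitRow D c = some h := by
  have h1 : v ∈ block m D (some (some h)) ↔ v ∈ rowList m D h := by
    simp only [block]
    split_ifs <;> simp
  rw [h1, rowList, List.mem_flatMap]
  simp only [List.mem_finRange, true_and, mem_cellBlock]
  constructor
  · rintro ⟨r, h | ⟨c, h⟩⟩
    · exact Or.inl ⟨r, h⟩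
    · exact Or.inr ⟨c, h.1, h.2.1⟩
  · rintro (⟨r, h⟩ | ⟨c, h2⟩)
    · exact ⟨r, Or.inl h⟩
    · exact ⟨⟨3 * gap c + 2, by have := gap_lt c; unfold rowLen; omega⟩,
        Or.inr ⟨c, h2.1, h2.2, rfl⟩⟩

lemma mem_block_iff (D : Bool → Fin ℓ → Bool) (k : Option (Option (RowIndex ℓ)))
    (v : Vert ℓ m) : v ∈ block m D k ↔ blockIndex D v = k := by
  rcases k with _ | _ | h
  · cases v <;> simp [block, blockIndex]
  · rcases v with _ | _ | ⟨σ, k, i⟩ | σ | _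
    · simp [block, blockIndex]
    · simp [block, blockIndex]
    · simp only [blockIndex, Option.some.injEq, visitRow_eq_none_iff, block, List.mem_cons,
        Vert.clause.injEq, Prod.mk.injEq, reduceCtorEq, List.not_mem_nil, or_false, false_or]
      cases σ <;> cases k <;> simp
    · cases σ <;> simp [block, blockIndex]
    · simp [block, blockIndex]
  · rw [mem_block_some_some]
    cases v <;> simp [blockIndex]

lemma nodup_block (D : Bool → Fin ℓ → Bool) (k : Option (Option (RowIndex ℓ))) :
    (block m D k).Nodup := by
  rcases k with _ | _ | h
  · exact (List.nodup_finRange _).map fun a b h => by simpa using h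
  · simp [block]
  · simp only [block]
    split_ifs
    · exact nodup_rowList D h
    · exact List.nodup_reverse.mpr (nodup_rowList D h)

lemma isChain_block {D : Bool → Fin ℓ → Bool} (hX : ∀ σ, X σ (D false) (D true))
    (k : Option (Option (RowIndex ℓ))) : (block m D k).IsChain (Arc X) := by
  rcases k with _ | _ | h
  · rw [block, List.isChain_map]
    exact (List.pairwise_lt_finRange (m + 1)).isChain
  · simp [block, Arc, hX]
  · have h1 := isChain_rowList (X := X) (m := m) D h
    simp only [block]
    split_ifs with hd
    · simpa only [hd, if_true] using h1
    · rw [List.isChain_reverse]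
      simpa [hd] using h1

lemma port_of_mem_block {D : Bool → Fin ℓ → Bool} {h : RowIndex ℓ} {v : Vert ℓ m}
    (hv : v ∈ (block m D (some (some h))).head? ∨ v ∈ (block m D (some (some h))).getLast?) :
    ∃ r, v = .cell h r ∧ IsPort r := by
  have h1 : v ∈ (rowList m D h).head? ∨ v ∈ (rowList m D h).getLast? := by
    simp only [block] at hv
    split_ifs at hv
    · exact hv
    · rwa [List.head?_reverse, List.getLast?_reverse, or_comm] at hv
  rw [head?_rowList, getLast?_rowList] at h1
  rcases h1 with h1 | h1
  · exact ⟨_, (Option.some_injective _ h1).symm, Or.inl rfl⟩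
  · exact ⟨_, (Option.some_injective _ h1).symm, Or.inr rfl⟩

/-- If the pair with coordinates `D false` and `D true` belongs to the sets of both players, then
the concatenation of the blocks is a Hamiltonian path. -/
theorem exists_isDirHamPath (e : Vert ℓ m ≃ Fin n) {D : Bool → Fin ℓ → Bool}
    (hX : ∀ σ, X σ (D false) (D true)) : ∃ l, IsDirHamPath (gadgetGraph e X) l := by
  refine ⟨((blockOrder ℓ).flatMap (block m D)).map e, ?_, ?_, ?_⟩
  · refine List.Nodup.map e.injective (List.nodup_flatMap.mpr ⟨fun k _ => nodup_block D k, ?_⟩)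
    refine (nodup_blockOrder ℓ).imp fun {k k'} hne => ?_
    rw [Function.onFun, List.disjoint_left]
    intro v h1 h2
    rw [mem_block_iff] at h1 h2
    exact hne (h1.symm.trans h2)
  · intro v
    refine List.mem_map.mpr ⟨e.symm v, List.mem_flatMap.mpr ⟨blockIndex D (e.symm v),
      mem_blockOrder _, (mem_block_iff D _ _).mpr rfl⟩, by simp⟩
  · have hne : [] ∉ (blockOrder ℓ).map (block m D) := by
      rw [List.mem_map]
      rintro ⟨k, _, hk⟩
      rcases k with _ | _ | h
      · simp [block, List.finRange_succ] at hk
      · simp [block] at hk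
      · have := head?_rowList (m := m) D h
        simp only [block] at hk
        split_ifs at hk <;> simp_all
    rw [List.isChain_map]
    simp only [gadgetGraph, Equiv.symm_apply_apply]
    rw [List.flatMap_def, List.isChain_flatten hne]
    refine ⟨fun l hl => ?_, ?_⟩
    · obtain ⟨k, _, rfl⟩ := List.mem_map.mp hl
      exact isChain_block hX k
    · have hpad : ∀ x ∈ (block m D none).getLast?, ∃ a, x = Vert.pad a := by
        intro x hx
        obtain ⟨a, _, rfl⟩ := List.mem_map.mp (List.mem_of_mem_getLast? hx)
        exact ⟨a, rfl⟩
      have hfin : ∀ y ∈ (block m D (some none)).head?,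
          y = Vert.clause (false, false, D false) := by
        intro y hy
        simp only [block, List.head?_cons, Option.mem_def, Option.some.injEq] at hy
        exact hy.symm
      rw [List.isChain_map, blockOrder, List.isChain_cons, List.isChain_append]
      refine ⟨?_, ?_, by simp, ?_⟩
      · intro k hk x hx y hy
        obtain ⟨a, rfl⟩ := hpad x hx
        have hk' := List.mem_of_mem_head? hk
        simp only [List.mem_append, List.mem_map, List.mem_singleton] at hk'
        rcases hk' with ⟨h, _, rfl⟩ | rfl
        · obtain ⟨r, rfl, hr⟩ := port_of_mem_block (Or.inl hy)
          exact hr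
        · rw [hfin y hy]
          rfl
      · rw [List.isChain_map]
        refine (Finset.nodup_toList _).isChain.imp fun h h' hne x hx y hy => ?_
        obtain ⟨r, rfl, hr⟩ := port_of_mem_block (Or.inr hx)
        obtain ⟨r', rfl, hr'⟩ := port_of_mem_block (Or.inl hy)
        exact Or.inr ⟨hne, hr, hr'⟩
      · intro k hk k' hk' x hx y hy
        obtain ⟨h, _, rfl⟩ := List.mem_map.mp (List.mem_of_mem_getLast? hk)
        obtain rfl : some none = k' := by simpa using hk'
        obtain ⟨r, rfl, hr⟩ := port_of_mem_block (Or.inr hx)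
        rw [hfin y hy]
        exact Or.inr (Or.inr ⟨hr, rfl, rfl⟩)

end Construction

/-! ### The bound in terms of the number of bits -/

section Reduction

variable {ℓ m n b T : ℕ} {Ω : Type} [MeasurableSpace Ω] {μ : Measure Ω} [IsProbabilityMeasure μ]

/-- The bound that the communication complexity of disjointness on `4 ^ ℓ` elements gives for an
algorithm with bandwidth `b` that runs for `T` rounds. -/
def RoundBound (ℓ b T : ℕ) : Prop :=
  Real.exp ((4 : ℝ) ^ ℓ / 480) ≤
    3000 * ((3 ^ b) ^ (T * (8 * ℓ + 2)) * 2 ^ (2 * ℓ + 1) * 2 ^ (2 * ℓ + 1) : ℝ) ^ 8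

lemma roundBound_of_solvesInRounds {Out : Type} {A : Ω → CongestAlgorithm n b Out}
    {Correct : Digraph (Fin n) → (Fin n → Out) → Prop} (hsol : SolvesInRounds μ A Correct T)
    (e : Vert ℓ m ≃ Fin n) {α : Type} [Fintype α] (hα : Fintype.card α ≤ 2 ^ (2 * ℓ + 1))
    (infoA infoB : Finset ((Fin ℓ → Bool) × (Fin ℓ → Bool)) → (Fin n → Out) → α)
    (hinfoA : ∀ x o o', (∀ v, side v = false → o (e v) = o' (e v)) → infoA x o = infoA x o')
    (hinfoB : ∀ y o o', (∀ v, side v = true → o (e v) = o' (e v)) → infoB y o = infoB y o')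
    (acc : α → α → Prop)
    (hdis : ∀ x y o, Disjoint x y → Correct (gadgetGraph e (pairInput x y)) o →
      ¬ acc (infoA x o) (infoB y o))
    (hmeet : ∀ x y o, ¬ Disjoint x y → Correct (gadgetGraph e (pairInput x y)) o →
      acc (infoA x o) (infoB y o)) :
    RoundBound ℓ b T := by
  have key := exp_card_le_of_solvesInRounds hsol
    (fun x y => isInputGraph_gadgetGraph (X := pairInput x y) e) (isSplitFamily_gadgetGraph e)
    infoA infoB
    (fun x o o' h => hinfoA x o o' fun v hv => h (e v) (by simp [hv]))
    (fun y o o' h => hinfoB y o o' fun v hv => h (e v) (by simp [hv]))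
    acc hdis hmeet
  have hcard : (Fintype.card ((Fin ℓ → Bool) × (Fin ℓ → Bool)) : ℝ) = 4 ^ ℓ := by
    simp only [Fintype.card_prod, Fintype.card_fun, Fintype.card_bool, Fintype.card_fin]
    push_cast
    rw [← mul_pow]; norm_num
  rw [hcard] at key
  refine key.trans ?_
  have hα' : (Fintype.card α : ℝ) ≤ 2 ^ (2 * ℓ + 1) := by exact_mod_cast hα
  have h3 : (1 : ℝ) ≤ 3 ^ b := one_le_pow₀ (by norm_num)
  have hE := card_cutPairs_le e
  gcongr

lemma exists_mem_of_not_disjoint {x y : Finset ((Fin ℓ → Bool) × (Fin ℓ → Bool))}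
    (h : ¬ Disjoint x y) : ∃ D : Bool → Fin ℓ → Bool,
      ∀ σ, pairInput x y σ (D false) (D true) := by
  obtain ⟨⟨i, j⟩, hx, hy⟩ := Finset.not_disjoint_iff.mp h
  exact ⟨fun k => if k then j else i, fun σ => by cases σ <;> simpa [pairInput]⟩

lemma not_disjoint_of_isHamSucc {x y : Finset ((Fin ℓ → Bool) × (Fin ℓ → Bool))}
    {R : Vert ℓ m → Vert ℓ m → Prop} (hR : IsHamSucc (pairInput x y) R) : ¬ Disjoint x y :=
  Finset.not_disjoint_iff.mpr ⟨_, hR.selected false, hR.selected true⟩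

/-- For the decision problem each player tells whether all of his vertices accept. -/
theorem roundBound_of_decision {A : Ω → CongestAlgorithm n b Bool}
    (hsol : SolvesInRounds μ A CorrectDecision T) (e : Vert ℓ m ≃ Fin n) : RoundBound ℓ b T := by
  classical
  refine roundBound_of_solvesInRounds hsol e (α := Bool) ?_
    (fun _ o => decide (∀ v, side v = false → o (e v) = true))
    (fun _ o => decide (∀ v, side v = true → o (e v) = true)) ?_ ?_
    (fun a a' => a = true ∧ a' = true) ?_ ?_
  · rw [Fintype.card_bool]
    calc 2 = 2 ^ 1 := rfl
      _ ≤ 2 ^ (2 * ℓ + 1) := Nat.pow_le_pow_right (by norm_num) (by omega)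
  · intro _ o o' h
    simp only [decide_eq_decide]
    exact forall_congr' fun v => imp_congr_right fun hv => by rw [h v hv]
  · intro _ o o' h
    simp only [decide_eq_decide]
    exact forall_congr' fun v => imp_congr_right fun hv => by rw [h v hv]
  · rintro x y o hd hc ⟨h1, h2⟩
    rw [decide_eq_true_eq] at h1 h2
    have hall : ∀ v, o v = true := by
      intro v
      rw [← e.apply_symm_apply v]
      cases hs : side (e.symm v)
      exacts [h1 _ hs, h2 _ hs]
    obtain ⟨l, hl⟩ := hc.mp hall
    exact not_disjoint_of_isHamSucc (isHamSucc_of_isDirHamPath hl) hd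
  · intro x y o hd hc
    obtain ⟨D, hD⟩ := exists_mem_of_not_disjoint hd
    have hall := hc.mpr (exists_isDirHamPath e hD)
    simp only [decide_eq_true_eq]
    exact ⟨fun v _ => hall _, fun v _ => hall _⟩

open Classical in
/-- The directions of the rows as they appear from the outputs of the vertices of the first player
(for `s = 0`), or of the second one (for `s = 2 ^ (ℓ + 1) + 1`): the `s`-th triple of cells is
inspected. -/
noncomputable def outputDir (e : Vert ℓ m ≃ Fin n) (s : ℕ) (hs : 3 * s + 1 < rowLen ℓ)
    (o : Fin n → Option (Fin n)) (h : RowIndex ℓ) : Bool :=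
  decide (o (e (cellAt m h (3 * s) (by omega))) = some (e (cellAt m h (3 * s + 1) hs)))

open Classical in
/-- The information that a player extracts from the outputs: the directions of the rows, and whether
the pair with these bits belongs to the set of the player. -/
noncomputable def outputInfo (e : Vert ℓ m ≃ Fin n) (s : ℕ) (hs : 3 * s + 1 < rowLen ℓ)
    (x : Finset ((Fin ℓ → Bool) × (Fin ℓ → Bool))) (o : Fin n → Option (Fin n)) :
    (RowIndex ℓ → Bool) × Bool :=
  (outputDir e s hs o,
    decide ((fun t => outputDir e s hs o (false, t), fun t => outputDir e s hs o (true, t)) ∈ x))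

/-- For the search problem each player tells the selected pair, as it appears from the outputs of
his vertices, and whether it belongs to his set. -/
theorem roundBound_of_search {A : Ω → CongestAlgorithm n b (Option (Fin n))}
    (hsol : SolvesInRounds μ A CorrectSearch T) (e : Vert ℓ m ≃ Fin n) : RoundBound ℓ b T := by
  classical
  have hs0 : 3 * 0 + 1 < rowLen ℓ := by unfold rowLen; omega
  have hs1 : 3 * (2 ^ (ℓ + 1) + 1) + 1 < rowLen ℓ := by unfold rowLen; omega
  refine roundBound_of_solvesInRounds hsol e (α := (RowIndex ℓ → Bool) × Bool) ?_
    (outputInfo e 0 hs0) (outputInfo e (2 ^ (ℓ + 1) + 1) hs1) ?_ ?_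
    (fun a a' => a.1 = a'.1 ∧ a.2 = true ∧ a'.2 = true) ?_ ?_
  · simp only [Fintype.card_prod, Fintype.card_fun, Fintype.card_bool, Fintype.card_fin]
    rw [pow_succ]
  · intro x o o' h
    have : outputDir e 0 hs0 o = outputDir e 0 hs0 o' := by
      funext r
      unfold outputDir
      rw [h _ (by simp [side])]
    simp only [outputInfo, this]
  · intro x o o' h
    have : outputDir e _ hs1 o = outputDir e _ hs1 o' := by
      funext r
      unfold outputDir
      rw [h _ (by simp only [side, decide_eq_true_eq]; omega)]
    simp only [outputInfo, this]
  · rintro x y o hd _ ⟨h1, h2, h3⟩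
    simp only [outputInfo, decide_eq_true_eq] at h1 h2 h3
    rw [← h1] at h3
    exact Finset.not_disjoint_iff.mpr ⟨_, h2, h3⟩ hd
  · intro x y o hd hc
    obtain ⟨D, hD⟩ := exists_mem_of_not_disjoint hd
    obtain ⟨l, hl, hout⟩ := hc (exists_isDirHamPath e hD)
    have hR := isHamSucc_of_isDirHamPath hl
    have hiff : ∀ u v, (o (e u) = some (e v)) ↔
        ∃ (i : ℕ) (hi : i + 1 < l.length), l[i] = e u ∧ l[i + 1] = e v := by
      intro u v
      constructor
      · intro h
        obtain ⟨i, hi, h1⟩ := List.getElem_of_mem (hl.2.1 (e u))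
        have h2 := hout i hi
        rw [h1, h] at h2
        obtain ⟨hi', h3⟩ := List.getElem?_eq_some_iff.mp h2.symm
        exact ⟨i, hi', h1, h3⟩
      · rintro ⟨i, hi, h1, h2⟩
        rw [← h1, hout i (by omega), List.getElem?_eq_getElem hi, h2]
    have hdir : ∀ s (hs : 3 * s + 1 < rowLen ℓ), outputDir e s hs o =
        IsHamSucc.dir fun u v => ∃ (i : ℕ) (hi : i + 1 < l.length), l[i] = e u ∧ l[i + 1] = e v := by
      intro s hs
      funext r
      have hs' : 3 * s + 2 < rowLen ℓ := by have := rowLen_mod ℓ; omega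
      unfold outputDir IsHamSucc.dir
      rw [decide_eq_decide, ← hR.forward_iff_zero r s hs', hiff]
      exact ⟨fun h => ⟨hs', h⟩, fun h => h.2⟩
    simp only [outputInfo, hdir, decide_eq_true_eq, true_and]
    exact ⟨hR.selected false, hR.selected true⟩

end Reduction

/-! ### Asymptotics -/

lemma pow_le_of_roundBound {ℓ b T : ℕ} (h : RoundBound ℓ b T) :
    (4 : ℝ) ^ ℓ / 480 ≤ 12 + 16 * b * T * (8 * ℓ + 2) + 8 * (4 * ℓ + 2) := by
  have h1 : (2 : ℝ) ≤ Real.exp 1 := by linarith [Real.add_one_le_exp (1 : ℝ)]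
  have h2 : (3 : ℝ) ≤ Real.exp 2 := by linarith [Real.add_one_le_exp (2 : ℝ)]
  have h3 : (3000 : ℝ) ≤ Real.exp 12 := by
    calc (3000 : ℝ) ≤ 2 ^ 12 := by norm_num
      _ ≤ Real.exp 1 ^ 12 := by gcongr
      _ = Real.exp 12 := by rw [← Real.exp_nat_mul]; norm_num
  rw [← Real.exp_le_exp]
  refine h.trans ?_
  calc _ ≤ Real.exp 12 * ((Real.exp 2 ^ b) ^ (T * (8 * ℓ + 2)) * Real.exp 1 ^ (2 * ℓ + 1) *
        Real.exp 1 ^ (2 * ℓ + 1)) ^ 8 := by gcongr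
    _ = _ := by
        simp only [← Real.exp_nat_mul, ← Real.exp_add]
        congr 1
        push_cast
        ring

lemma linear_le_four_pow {ℓ : ℕ} (h : 10 ≤ ℓ) : 960 * (32 * ℓ + 28) ≤ 4 ^ ℓ := by
  induction ℓ, h using Nat.le_induction with
  | base => norm_num
  | succ k hk ih => rw [pow_succ]; omega

/-- The largest admissible number of bits gives the claimed bound. -/
lemma exists_const_of_roundBound {b : ℕ → ℕ}
    (hb : (fun n : ℕ => (b n : ℝ)) =O[atTop] fun n : ℕ => Real.log n) :
    ∃ c : ℝ, 0 < c ∧ ∀ᶠ n : ℕ in atTop, ∀ T : ℕ,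
      (∀ ℓ m, ∀ _ : Vert ℓ m ≃ Fin n, RoundBound ℓ (b n) T) →
        c * ((n : ℝ) ^ 2 / Real.log n ^ 4) ≤ T := by
  obtain ⟨B, hB, hbB⟩ := hb.exists_pos
  rw [IsBigOWith] at hbB
  set M : ℝ := 168 ^ 2 * 960 * 160 * 8 * B with hM
  have hMpos : 0 < M := by positivity
  refine ⟨1 / M, by positivity, ?_⟩
  filter_upwards [hbB, eventually_ge_atTop (42 * (10 * 2 ^ 10))] with n hbn hn T hT
  set P : ℕ → Prop := fun ℓ => 42 * (ℓ * 2 ^ ℓ) ≤ n with hP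
  set ℓ := Nat.findGreatest P n with hℓ
  have hPℓ : P ℓ := Nat.findGreatest_spec (P := P) (m := 10) (by omega) hn
  have hℓ10 : 10 ≤ ℓ := Nat.le_findGreatest (by omega) hn
  have hlt : n < 42 * ((ℓ + 1) * 2 ^ (ℓ + 1)) := by
    by_contra! hle
    have h1 : ℓ + 1 ≤ n := by
      have : (ℓ + 1) * 1 ≤ (ℓ + 1) * 2 ^ (ℓ + 1) := Nat.mul_le_mul_left _ Nat.one_le_two_pow
      omega
    have := Nat.le_findGreatest (P := P) h1 hle
    omega
  obtain ⟨m, ⟨e⟩⟩ := exists_vert_equiv (by omega) hPℓ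
  have hmain := pow_le_of_roundBound (hT ℓ m e)
  have hlin : (960 * (32 * ℓ + 28) : ℝ) ≤ 4 ^ ℓ := by exact_mod_cast linear_le_four_pow hℓ10
  have hn1 : (1 : ℝ) < n := by exact_mod_cast (by omega : 1 < n)
  have hlog : 0 < Real.log n := Real.log_pos hn1
  set L := Real.log n with hL
  have hbL : (b n : ℝ) ≤ B * L := by
    have h1 := hbn
    rw [Real.norm_of_nonneg (Nat.cast_nonneg _), Real.norm_of_nonneg hlog.le] at h1
    exact h1
  have hℓL : (ℓ : ℝ) ≤ 2 * L := by
    have h1 : 2 ^ ℓ ≤ n := by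
      have : 1 * 2 ^ ℓ ≤ ℓ * 2 ^ ℓ := Nat.mul_le_mul_right _ (by omega)
      simp only [hP] at hPℓ
      omega
    have h2 : Real.log ((2 : ℝ) ^ ℓ) ≤ L := Real.log_le_log (by positivity) (by exact_mod_cast h1)
    rw [Real.log_pow] at h2
    have h3 := Real.log_two_gt_d9
    have h4 : (0 : ℝ) ≤ ℓ := by positivity
    nlinarith
  have hℓ1 : (10 : ℝ) ≤ ℓ := by exact_mod_cast hℓ10
  have h4 : (4 : ℝ) ^ ℓ ≤ 960 * 160 * B * L * T * ℓ := by
    have h5 : (4 : ℝ) ^ ℓ ≤ 960 * (16 * b n * T * (8 * ℓ + 2)) := by linarith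
    refine h5.trans ?_
    have h6 : (8 * ℓ + 2 : ℝ) ≤ 10 * ℓ := by linarith
    calc 960 * (16 * (b n : ℝ) * T * (8 * ℓ + 2)) ≤ 960 * (16 * (B * L) * T * (10 * ℓ)) := by gcongr
      _ = _ := by ring
  have hn2 : (n : ℝ) ≤ 168 * ℓ * 2 ^ ℓ := by
    have h1 : (n : ℝ) ≤ 42 * ((ℓ + 1) * 2 ^ (ℓ + 1)) := by exact_mod_cast hlt.le
    have h2 : (0 : ℝ) < 2 ^ ℓ := by positivity
    calc (n : ℝ) ≤ 42 * ((ℓ + 1) * 2 ^ (ℓ + 1)) := h1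
      _ ≤ 42 * ((2 * ℓ) * 2 ^ (ℓ + 1)) := by gcongr; linarith
      _ = _ := by rw [pow_succ]; ring
  have hsq : (n : ℝ) ^ 2 ≤ M * L ^ 4 * T := by
    calc (n : ℝ) ^ 2 ≤ (168 * (ℓ : ℝ) * 2 ^ ℓ) ^ 2 := by gcongr
      _ = 168 ^ 2 * (ℓ : ℝ) ^ 2 * 4 ^ ℓ := by
          rw [mul_pow, mul_pow, ← pow_mul, mul_comm ℓ 2, pow_mul]; norm_num
      _ ≤ 168 ^ 2 * (ℓ : ℝ) ^ 2 * (960 * 160 * B * L * T * ℓ) := by gcongr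
      _ = 168 ^ 2 * 960 * 160 * B * L * T * ℓ ^ 3 := by ring
      _ ≤ 168 ^ 2 * 960 * 160 * B * L * T * (2 * L) ^ 3 := by gcongr
      _ = _ := by rw [hM]; ring
  rw [div_mul_eq_mul_div, one_mul, div_div, div_le_iff₀ (by positivity)]
  linarith

theorem mainTheorem2 (b : ℕ → ℕ)
    (hb : (fun n : ℕ => (b n : ℝ)) =O[atTop] fun n : ℕ => Real.log n) :
    (∃ c : ℝ, 0 < c ∧ ∀ᶠ n : ℕ in atTop,
      ∀ (Ω : Type) [MeasurableSpace Ω] (μ : Measure Ω) [IsProbabilityMeasure μ]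
        (A : Ω → CongestAlgorithm n (b n) (Option (Fin n))) (T : ℕ),
        SolvesInRounds μ A CorrectSearch T →
          c * ((n : ℝ) ^ 2 / Real.log n ^ 4) ≤ T) ∧
    (∃ c : ℝ, 0 < c ∧ ∀ᶠ n : ℕ in atTop,
      ∀ (Ω : Type) [MeasurableSpace Ω] (μ : Measure Ω) [IsProbabilityMeasure μ]
        (A : Ω → CongestAlgorithm n (b n) Bool) (T : ℕ),
        SolvesInRounds μ A CorrectDecision T →
          c * ((n : ℝ) ^ 2 / Real.log n ^ 4) ≤ T) := by
  obtain ⟨c, hc, hev⟩ := exists_const_of_roundBound hb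
  refine ⟨⟨c, hc, ?_⟩, ⟨c, hc, ?_⟩⟩
  · filter_upwards [hev] with n hn Ω _ μ _ A T hsol
    exact hn T fun ℓ m e => roundBound_of_search hsol e
  · filter_upwards [hev] with n hn Ω _ μ _ A T hsol
    exact hn T fun ℓ m e => roundBound_of_decision hsol e
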